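/- Consider, for $\nu>0$, $\beta\in\mathbb R$, $\gamma\neq0$, the KdV–Burgers–Sivashinsky (KBS) equation $$u_t-\nu u_{xx}+uu_x-\beta u+\gamma u_{xxx}=f,\qquad u(0)=u_0,$$ on the torus $\mathbb T=[-\frac L2,\frac L2]$ of length $L>0$. Let $H$ be the space of mean-zero functions in $L^2_{per}(\mathbb T)$ with the $L^2$ norm $|\cdot|$, let $V$ be the space of mean-zero functions in $H^1_{per}(\mathbb T)$, let $f\in V'$ be independent of time, and put $N:=|A^{-1/2}f|=\inf\{C\ge 0: |\langle f,\varphi\rangle|\le C|\varphi_x| \text{ for all }\varphi\in V\}$, where $A=-\partial_{xx}$. A solution with initial value $u_0\in H$ is a function $u\in C([0,\infty);H)\cap L^2_{loc}([0,\infty);V)$ with $u(0)=u_0$ that satisfies the equation weakly. We say that the ball of radius $\rho$ in $H$ is absorbing if for every $R$ there is a time $t_1\ge 0$ such that $|u(t)|\le\rho$ for all $t\ge t_1$ and every solution $u$ with $|u_0|\le R$ (so $t_1$ depends on $u_0$ only through a bound for $|u_0|$; it may depend on $L,\nu,\beta,\gamma,f$). There is an absolute constant $c>0$ such that, for all $L>0$,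 $\nu>0$, $\gamma\ne0$ and $f\in V'$: 1. if $\beta>0$, the ball of radius $\rho_0$ in $H$ is absorbing, where $$\rho_0^2=c\Big(\beta^2L^3+\frac{N^2}{\nu\beta}+\nu\beta L+\frac{\gamma^2}{\nu^4}\beta^4L^5\Big);$$ 2. if $\beta\ge1$, the ball of radius $\rho$ in $H$ is absorbing, where $$\rho^2=c\Big(\beta^2L^3+\frac{N^2}{\nu\beta}+\nu\beta^2L+\beta^3L^3+\frac{\gamma^2}{\nu^4}\beta^5L^5\Big);$$ 3. if $\nu\le1$ and $L,\beta,|\gamma|\ge1$, the ball whose radius has the square $c\big(\frac{N^2}{\nu\beta}+\frac{\gamma^2}{\nu^4}\beta^5L^5\big)$ is absorbing; 4. if $\beta\le0$, every ball in $H$ of radius $r>0$ with $r^2>\dfrac{N^2}{\nu\,(\nu(2\pi/L)^2-2\beta)}$ is absorbing. Moreover, the radius $\rho=\rho(L,\nu,\beta,\gamma,N)$ in 2, regarded as a function of one of the parameters with the others ($L,\nu,\beta>0$, $\gamma\neq0$, $N\ge0$) fixed, satisfies $$\rho\sim L^{5/2}\ (L\to\infty),\qquad \rho\sim\frac1{\nu^2}\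 (\nu\to0^+),\qquad \rho\sim\beta^{5/2}\ (\beta\to\infty),\qquad \rho\sim|\gamma|\ (|\gamma|\to\infty),$$ where $\sim$ means that each side is bounded by a constant times the other in the limit; the constants may depend on the fixed parameters. -/

import Mathlib

open MeasureTheory Set Filter Topology Asymptotics
open scoped ContDiff

namespace KBS

noncomputable section

/-- Lebesgue measure on one period `(-L/2, L/2]` of the torus `𝕋` of length `L`. -/
abbrev perMeas (L : ℝ) : Measure ℝ := volume.restrict (Ioc (-(L / 2)) (L / 2))

/-- `L²_per(𝕋)`; an `L`-periodic function is identified with its restriction to one period. -/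
abbrev L2per (L : ℝ) : Type := Lp ℝ 2 (perMeas L)

/-- Smooth `L`-periodic functions `ℝ → ℝ`, i.e. smooth functions on the torus. -/
structure IsTest (L : ℝ) (φ : ℝ → ℝ) : Prop where
  smooth : ContDiff ℝ ∞ φ
  periodic : Function.Periodic φ L

theorem L2per.integrable {L : ℝ} (g : L2per L) : Integrable (fun x => g x) (perMeas L) :=
  (Lp.memLp g).integrable (by norm_num)

theorem memLp_of_continuous {L : ℝ} {φ : ℝ → ℝ} (hφ : Continuous φ) :
    MemLp φ 2 (perMeas L) := by
  obtain ⟨C, hC⟩ := (isCompact_Icc (a := -(L / 2)) (b := L / 2)).exists_bound_of_continuousOn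
    hφ.continuousOn
  refine MemLp.of_bound hφ.aestronglyMeasurable C ?_
  filter_upwards [ae_restrict_mem measurableSet_Ioc] with x hx
  exact hC x (Ioc_subset_Icc_self hx)

theorem IsTest.memLp {L : ℝ} {φ : ℝ → ℝ} (hφ : IsTest L φ) : MemLp φ 2 (perMeas L) :=
  memLp_of_continuous hφ.smooth.continuous

theorem IsTest.deriv {L : ℝ} {φ : ℝ → ℝ} (hφ : IsTest L φ) : IsTest L (deriv φ) where
  smooth := ((contDiff_infty_iff_deriv (𝕜 := ℝ)).1 hφ.smooth).2
  periodic := fun x => by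
    rw [← deriv_comp_add_const]
    congr 1
    funext y
    exact hφ.periodic y

theorem L2per.integrable_mul {L : ℝ} (g : L2per L) {φ : ℝ → ℝ} (hφ : IsTest L φ) :
    Integrable (fun x => g x * φ x) (perMeas L) :=
  (Lp.memLp g).integrable_mul hφ.memLp

/-- The energy space `H`: elements of `L²_per(𝕋)` with mean value zero, with the `L²` norm. -/
def HSpace (L : ℝ) : Submodule ℝ (L2per L) where
  carrier := {g | ∫ x, g x ∂(perMeas L) = 0}
  zero_mem' := by
    change ∫ x, (0 : L2per L) x ∂(perMeas L) = 0
    rw [integral_congr_ae (Lp.coeFn_zero ℝ 2 (perMeas L))]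
    simp
  add_mem' := by
    intro a b ha hb
    change ∫ x, (a + b : L2per L) x ∂(perMeas L) = 0
    rw [integral_congr_ae (Lp.coeFn_add a b)]
    simp only [Pi.add_apply]
    rw [integral_add a.integrable b.integrable, show ∫ x, a x ∂(perMeas L) = 0 from ha,
      show ∫ x, b x ∂(perMeas L) = 0 from hb, add_zero]
  smul_mem' := by
    intro c a ha
    change ∫ x, (c • a : L2per L) x ∂(perMeas L) = 0
    rw [integral_congr_ae (Lp.coeFn_smul c a)]
    simp only [Pi.smul_apply, smul_eq_mul]
    rw [integral_const_mul, show ∫ x, a x ∂(perMeas L) = 0 from ha, mul_zero]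

/-- `h ∈ L²_per(𝕋)` is the weak derivative, on the torus, of `g ∈ L²_per(𝕋)`. -/
def HasWeakDeriv {L : ℝ} (g h : L2per L) : Prop :=
  ∀ ψ : ℝ → ℝ, IsTest L ψ →
    ∫ x, g x * deriv ψ x ∂(perMeas L) = -∫ x, h x * ψ x ∂(perMeas L)

/-- The space `V` of mean-zero functions in `H¹_per(𝕋)`, as the space of pairs `(φ, φ_x)` of a
function and its weak derivative.  The norm inherited from the `ℓ²` product is the
`H¹` norm `(|φ|² + |φ_x|²)^(1/2)`. -/
def VSpace (L : ℝ) : Submodule ℝ (WithLp 2 (L2per L × L2per L)) where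
  carrier := {p | p.fst ∈ HSpace L ∧ HasWeakDeriv p.fst p.snd}
  zero_mem' := by
    refine ⟨(HSpace L).zero_mem, fun ψ _ => ?_⟩
    have h0 : ∀ χ : ℝ → ℝ, ∫ x, (0 : L2per L) x * χ x ∂(perMeas L) = 0 := fun χ => by
      rw [integral_congr_ae (g := fun _ => (0 : ℝ))]
      · simp
      · filter_upwards [Lp.coeFn_zero ℝ 2 (perMeas L)] with x hx
        exact (congrArg (· * χ x) hx).trans (zero_mul _)
    simp only [WithLp.zero_fst, WithLp.zero_snd]
    rw [h0, h0, neg_zero]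
  add_mem' := by
    intro p q hp hq
    refine ⟨(HSpace L).add_mem hp.1 hq.1, fun ψ hψ => ?_⟩
    have hadd : ∀ (a b : L2per L) (χ : ℝ → ℝ), IsTest L χ →
        ∫ x, (a + b : L2per L) x * χ x ∂(perMeas L)
          = (∫ x, a x * χ x ∂(perMeas L)) + ∫ x, b x * χ x ∂(perMeas L) := by
      intro a b χ hχ
      rw [← integral_add (a.integrable_mul hχ) (b.integrable_mul hχ)]
      refine integral_congr_ae ?_
      filter_upwards [Lp.coeFn_add a b] with x hx
      rw [hx, Pi.add_apply, add_mul]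
    simp only [WithLp.add_fst, WithLp.add_snd]
    rw [hadd _ _ _ hψ.deriv, hadd _ _ _ hψ, hp.2 ψ hψ, hq.2 ψ hψ]
    ring
  smul_mem' := by
    intro c p hp
    refine ⟨(HSpace L).smul_mem c hp.1, fun ψ hψ => ?_⟩
    have hsmul : ∀ (a : L2per L) (χ : ℝ → ℝ),
        ∫ x, (c • a : L2per L) x * χ x ∂(perMeas L) = c * ∫ x, a x * χ x ∂(perMeas L) := by
      intro a χ
      rw [← integral_const_mul]
      refine integral_congr_ae ?_
      filter_upwards [Lp.coeFn_smul c a] with x hx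
      rw [hx, Pi.smul_apply, smul_eq_mul, mul_assoc]
    simp only [WithLp.smul_fst, WithLp.smul_snd]
    rw [hsmul, hsmul, hp.2 ψ hψ]
    ring

theorem IsTest.hasWeakDeriv {L : ℝ} {φ : ℝ → ℝ} (hφ : IsTest L φ) :
    HasWeakDeriv (hφ.memLp.toLp φ) (hφ.deriv.memLp.toLp (_root_.deriv φ)) := by
  intro ψ hψ
  have hd : ∀ {χ : ℝ → ℝ}, IsTest L χ → ∀ x, HasDerivAt χ (_root_.deriv χ x) x := fun hχ x =>
    (hχ.smooth.differentiable (by simp) x).hasDerivAt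
  have e1 : ∫ x, (hφ.memLp.toLp φ) x * _root_.deriv ψ x ∂(perMeas L)
      = ∫ x, φ x * _root_.deriv ψ x ∂(perMeas L) := by
    refine integral_congr_ae ?_
    filter_upwards [hφ.memLp.coeFn_toLp] with x hx
    rw [hx]
  have e2 : ∫ x, (hφ.deriv.memLp.toLp (_root_.deriv φ)) x * ψ x ∂(perMeas L)
      = ∫ x, _root_.deriv φ x * ψ x ∂(perMeas L) := by
    refine integral_congr_ae ?_
    filter_upwards [hφ.deriv.memLp.coeFn_toLp] with x hx
    rw [hx]
  rw [e1, e2]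
  rcases le_total 0 L with hL | hL
  · have hle : -(L / 2) ≤ L / 2 := by linarith
    rw [← intervalIntegral.integral_of_le hle, ← intervalIntegral.integral_of_le hle,
      intervalIntegral.integral_mul_deriv_eq_deriv_mul (fun x _ => hd hφ x) (fun x _ => hd hψ x)
        (hφ.deriv.smooth.continuous.intervalIntegrable _ _)
        (hψ.deriv.smooth.continuous.intervalIntegrable _ _)]
    have h1 : φ (L / 2) = φ (-(L / 2)) := by
      rw [← hφ.periodic (-(L / 2))]; congr 1; ring
    have h2 : ψ (L / 2) = ψ (-(L / 2)) := by
      rw [← hψ.periodic (-(L / 2))]; congr 1; ring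
    rw [h1, h2]
    ring
  · have hs : perMeas L = 0 := by
      rw [perMeas, Ioc_eq_empty (by linarith), Measure.restrict_empty]
    rw [hs]
    simp

/-- A smooth mean-zero function on the torus, as an element of `V`. -/
def testV {L : ℝ} (φ : ℝ → ℝ) (hφ : IsTest L φ) (h0 : ∫ x, φ x ∂(perMeas L) = 0) : VSpace L :=
  ⟨WithLp.toLp 2 (hφ.memLp.toLp φ, hφ.deriv.memLp.toLp (deriv φ)),
    (integral_congr_ae hφ.memLp.coeFn_toLp).trans h0, hφ.hasWeakDeriv⟩

/-- The dual space `V'`. -/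
abbrev VDual (L : ℝ) : Type := VSpace L →L[ℝ] ℝ

/-- `|A^(-1/2) f|` for `f ∈ V'` and `A = -∂_xx`: since `|A^(1/2) φ| = |φ_x|` on `V`, this is the
norm of `f` dual to the norm `|φ_x|` on `V`. -/
def dualNorm {L : ℝ} (f : VDual L) : ℝ :=
  sInf {C : ℝ | 0 ≤ C ∧ ∀ φ : VSpace L, |f φ| ≤ C * ‖(φ : WithLp 2 (L2per L × L2per L)).snd‖}

/-- `u : [0,∞) → H` is a (weak) solution of
`u_t - ν u_xx + u u_x - β u + γ u_xxx = f`, `u(0) = u₀`, on the torus of length `L`: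
`u ∈ C([0,∞); H) ∩ L²_loc([0,∞); V)` and the equation holds, integrated in time, against every
smooth mean-zero function of `x`. Values `u t` with `t < 0` play no role. -/
structure IsSolution {L : ℝ} (ν β γ : ℝ) (f : VDual L) (u₀ : HSpace L) (u : ℝ → HSpace L) :
    Prop where
  init : u 0 = u₀
  continuousOn : ContinuousOn u (Ici 0)
  memL2V : ∃ v : ℝ → VSpace L,
    (∀ᵐ t ∂(volume.restrict (Ici (0 : ℝ))),
      (v t : WithLp 2 (L2per L × L2per L)).fst = (u t : L2per L)) ∧
    ∀ T : ℝ, 0 < T → MemLp v 2 (volume.restrict (Icc 0 T))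
  weak_eq : ∀ (φ : ℝ → ℝ) (hφ : IsTest L φ) (h0 : ∫ x, φ x ∂(perMeas L) = 0) (t : ℝ), 0 ≤ t →
    (∫ x, (u t : L2per L) x * φ x ∂(perMeas L)) - ∫ x, (u₀ : L2per L) x * φ x ∂(perMeas L)
      = ∫ s in (0 : ℝ)..t,
          (ν * (∫ x, (u s : L2per L) x * iteratedDeriv 2 φ x ∂(perMeas L))
            + (1 / 2) * (∫ x, (u s : L2per L) x ^ 2 * deriv φ x ∂(perMeas L))
            + β * (∫ x, (u s : L2per L) x * φ x ∂(perMeas L))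
            + γ * (∫ x, (u s : L2per L) x * iteratedDeriv 3 φ x ∂(perMeas L))
            + f (testV φ hφ h0))

/-- The ball of radius `ρ` in `H` is absorbing: every solution enters it (and stays in it) after
a time which, for the given equation, depends only on (a bound `R` for) `|u₀|`. -/
def AbsorbingBall {L : ℝ} (ν β γ : ℝ) (f : VDual L) (ρ : ℝ) : Prop :=
  ∀ R : ℝ, ∃ t₁ : ℝ, 0 ≤ t₁ ∧ ∀ (u₀ : HSpace L) (u : ℝ → HSpace L), ‖u₀‖ ≤ R →
    IsSolution ν β γ f u₀ u → ∀ t : ℝ, t₁ ≤ t → ‖u t‖ ≤ ρ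

/-- The radius
`ρ² = c (β²L³ + N²/(νβ) + νβ²L + β³L³ + γ²β⁵L⁵/ν⁴)`, where `N` stands for `|A^(-1/2) f|`. -/
def radius (c L ν β γ N : ℝ) : ℝ :=
  √(c * (β ^ 2 * L ^ 3 + N ^ 2 / (ν * β) + ν * β ^ 2 * L + β ^ 3 * L ^ 3
    + γ ^ 2 / ν ^ 4 * β ^ 5 * L ^ 5))

/-- The radius
`ρ² = c (β²L³ + N²/(νβ) + νβL + γ²β⁴L⁵/ν⁴)`, where `N` stands for `|A^(-1/2) f|`. -/
def sharpRadius (c L ν β γ N : ℝ) : ℝ :=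
  √(c * (β ^ 2 * L ^ 3 + N ^ 2 / (ν * β) + ν * β * L + γ ^ 2 / ν ^ 4 * β ^ 4 * L ^ 5))

end

end KBS

/-!
The proof follows the gauge function method of Nicolaenko–Scheurer–Temam and Goodman.

If the linear operator is stable, i.e. `ν (2π/L)² > 2β`, the energy equality, Young's inequality and
the sharp Wirtinger inequality (`wirtinger`) give exponential decay of `|u|²` up to
`N² / (ν (ν (2π/L)² - 2β))`; this is `absorbingBall_of_stable`. It covers `β ≤ 0` as well as
`β > 0` with `ν ≥ 8βL²`.

For `β > 0` and `ν < 8βL²`, one estimates instead the distance of `u` to the translates of a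
mean-zero periodic function `φ` with `φ_x = 4β (1 - L δ)`, where `δ` is a smooth probability
density concentrated at scale `ν / (βL)` (`exists_gauge`). In the time derivative of `|u - φ|²`, the
nonlinear term contributes `-∫ u² φ_x`, which turns the growth `2β |u|²` into decay, except for
the term `4βL ∫ δ u²`. By Hölder continuity of `H¹` functions the latter is at most
`4βL (∫ δ u)² + ν |u_x|² / 2` (`HasWeakDeriv.integral_sq_mul_le`), and if `φ` is the translate
closest to `u`, then `u` is orthogonal to `φ_x`, so that `∫ δ u = 0`. The remaining terms are
bounded by `|φ|²`, `|φ_x|²` and `|φ_xx|²`, the last one coming from dispersion; this is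
`IsGauge.rate_le`. As the minimal distance is bounded by the distance to the translate chosen at
any earlier time, Gronwall's inequality for lower right derivatives applies to it directly, and
the translation need not be followed in time (`IsGauge.decay`).

The energy equality for weak solutions (`IsSolution.energy`) is not the usual one, since `γ u_xxx`
need not belong to `L²(V')`. But the dispersive term cancels in the energy balance of every single
Fourier mode, and dominated convergence permits summation over the modes.

In `radius`, the term `γ² β⁵ L⁵ / ν⁴` dominates in each of the four limits.
-/

namespace KBS

/-! ### Fourier coefficients on the torus of length `L` -/

/-- The frequency `2πk/L` of the `k`-th Fourier mode on the torus of length `L`. -/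
noncomputable def freq (L : ℝ) (k : ℤ) : ℝ := 2 * Real.pi * k / L

/-- The unnormalised `k`-th cosine coefficient of `g` over one period. -/
noncomputable def cosCoeff (L : ℝ) (g : ℝ → ℝ) (k : ℤ) : ℝ :=
  ∫ x, g x * Real.cos (freq L k * x) ∂(perMeas L)

/-- The unnormalised `k`-th sine coefficient of `g` over one period. -/
noncomputable def sinCoeff (L : ℝ) (g : ℝ → ℝ) (k : ℤ) : ℝ :=
  ∫ x, g x * Real.sin (freq L k * x) ∂(perMeas L)

theorem fourierCoeffOn_ofReal {L : ℝ} (hab : -(L / 2) < L / 2) {g : ℝ → ℝ}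
    (hg : Integrable g (perMeas L)) (k : ℤ) :
    fourierCoeffOn hab (fun x => (g x : ℂ)) k
      = (1 / L : ℝ) * (cosCoeff L g k - Complex.I * sinCoeff L g k) := by
  have hc : Integrable (fun x => g x * Real.cos (freq L k * x)) (perMeas L) :=
    hg.mul_bdd (c := 1) (by fun_prop) (ae_of_all _ fun x => Real.abs_cos_le_one _)
  have hs : Integrable (fun x => g x * Real.sin (freq L k * x)) (perMeas L) :=
    hg.mul_bdd (c := 1) (by fun_prop) (ae_of_all _ fun x => Real.abs_sin_le_one _)
  have hL : L / 2 - -(L / 2) = L := by ring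
  rw [fourierCoeffOn_eq_integral, intervalIntegral.integral_of_le hab.le, hL, cosCoeff, sinCoeff,
    ← integral_complex_ofReal, ← integral_complex_ofReal, ← integral_const_mul,
    ← integral_sub hc.ofReal (hs.ofReal.const_mul _)]
  simp only [Complex.real_smul]
  congr 1
  refine integral_congr_ae (ae_of_all _ fun x => ?_)
  simp only [fourier_coe_apply, smul_eq_mul]
  have e : 2 * (Real.pi : ℂ) * Complex.I * ((-k : ℤ) : ℂ) * (x : ℂ) / (L : ℂ)
      = ((-(freq L k * x) : ℝ) : ℂ) * Complex.I := by
    rw [freq]; push_cast; ring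
  rw [e, Complex.exp_mul_I, ← Complex.ofReal_cos, ← Complex.ofReal_sin, Real.cos_neg, Real.sin_neg]
  push_cast
  ring

/-- Parseval's identity in real form. -/
theorem hasSum_sq_coeff {L : ℝ} (hL : 0 < L) {g : ℝ → ℝ} (hg : MemLp g 2 (perMeas L)) :
    HasSum (fun k : ℤ => cosCoeff L g k ^ 2 + sinCoeff L g k ^ 2)
      (L * ∫ x, g x ^ 2 ∂(perMeas L)) := by
  have hab : -(L / 2) < L / 2 := by linarith
  have h := hasSum_sq_fourierCoeffOn (f := fun x => (g x : ℂ)) hab hg.ofReal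
  have hL' : L / 2 - -(L / 2) = L := by ring
  rw [intervalIntegral.integral_of_le hab.le, hL'] at h
  have h2 := h.mul_left (L ^ 2)
  convert! h2 using 1
  · funext k
    rw [fourierCoeffOn_ofReal hab (hg.integrable (by norm_num)), norm_mul, mul_pow,
      Complex.norm_real, Real.norm_eq_abs, sq_abs, ← Complex.normSq_eq_norm_sq,
      Complex.normSq_apply]
    simp
    field_simp
  · simp only [Complex.norm_real, Real.norm_eq_abs, sq_abs, smul_eq_mul]
    field_simp

theorem cosCoeff_add {L : ℝ} {g h : ℝ → ℝ} (hg : Integrable g (perMeas L))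
    (hh : Integrable h (perMeas L)) (k : ℤ) :
    cosCoeff L (fun x => g x + h x) k = cosCoeff L g k + cosCoeff L h k := by
  have hb : ∀ {g : ℝ → ℝ}, Integrable g (perMeas L) →
      Integrable (fun x => g x * Real.cos (freq L k * x)) (perMeas L) := fun hg =>
    hg.mul_bdd (c := 1) (by fun_prop) (ae_of_all _ fun x => Real.abs_cos_le_one _)
  simp only [cosCoeff, add_mul]
  exact integral_add (hb hg) (hb hh)

theorem sinCoeff_add {L : ℝ} {g h : ℝ → ℝ} (hg : Integrable g (perMeas L))
    (hh : Integrable h (perMeas L)) (k : ℤ) :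
    sinCoeff L (fun x => g x + h x) k = sinCoeff L g k + sinCoeff L h k := by
  have hb : ∀ {g : ℝ → ℝ}, Integrable g (perMeas L) →
      Integrable (fun x => g x * Real.sin (freq L k * x)) (perMeas L) := fun hg =>
    hg.mul_bdd (c := 1) (by fun_prop) (ae_of_all _ fun x => Real.abs_sin_le_one _)
  simp only [sinCoeff, add_mul]
  exact integral_add (hb hg) (hb hh)

/-- The contribution of the `k`-th Fourier mode to `∫ g h` (up to the factor `L`). -/
noncomputable def modePairing (L : ℝ) (g h : ℝ → ℝ) (k : ℤ) : ℝ :=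
  cosCoeff L g k * cosCoeff L h k + sinCoeff L g k * sinCoeff L h k

/-- The polarised form of Parseval's identity. -/
theorem hasSum_modePairing {L : ℝ} (hL : 0 < L) {g h : ℝ → ℝ} (hg : MemLp g 2 (perMeas L))
    (hh : MemLp h 2 (perMeas L)) :
    HasSum (modePairing L g h) (L * ∫ x, g x * h x ∂(perMeas L)) := by
  have h1 := hasSum_sq_coeff hL hg
  have h2 := hasSum_sq_coeff hL hh
  have h3 := hasSum_sq_coeff hL (g := fun x => g x + h x) (hg.add hh)
  have hgi := hg.integrable (by norm_num : (1 : ENNReal) ≤ 2)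
  have hhi := hh.integrable (by norm_num : (1 : ENNReal) ≤ 2)
  have h4 := ((h3.sub h1).sub h2).mul_left (1 / 2)
  convert! h4 using 1
  · funext k
    rw [modePairing, cosCoeff_add hgi hhi, sinCoeff_add hgi hhi]
    ring
  · have e : ∫ x, (g x + h x) ^ 2 ∂(perMeas L) = (∫ x, g x ^ 2 ∂(perMeas L))
        + 2 * (∫ x, g x * h x ∂(perMeas L)) + ∫ x, h x ^ 2 ∂(perMeas L) := by
      have hm : Integrable (fun x => 2 * (g x * h x)) (perMeas L) :=
        (hg.integrable_mul hh).const_mul 2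
      have hs : Integrable (fun x => g x ^ 2 + 2 * (g x * h x)) (perMeas L) :=
        hg.integrable_sq.add hm
      rw [← integral_const_mul, ← integral_add hg.integrable_sq hm,
        ← integral_add hs hh.integrable_sq]
      refine integral_congr_ae (ae_of_all _ fun x => ?_)
      ring
    rw [e]
    ring

/-- A square integrable function all of whose Fourier coefficients vanish is null. -/
theorem ae_eq_zero_of_coeff_eq_zero {L : ℝ} (hL : 0 < L) {g : ℝ → ℝ} (hg : MemLp g 2 (perMeas L))
    (h : ∀ k, cosCoeff L g k = 0 ∧ sinCoeff L g k = 0) : g =ᵐ[perMeas L] 0 := by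
  have h1 := hasSum_sq_coeff hL hg
  simp only [h, ne_eq, OfNat.ofNat_ne_zero, not_false_eq_true, zero_pow, add_zero] at h1
  have h2 := h1.unique hasSum_zero
  have h3 : ∫ x, g x ^ 2 ∂(perMeas L) = 0 := by
    rcases mul_eq_zero.1 h2 with h | h
    · exact absurd h hL.ne'
    · exact h
  have h4 := (integral_eq_zero_iff_of_nonneg (fun x => sq_nonneg (g x)) hg.integrable_sq).1 h3
  filter_upwards [h4] with x hx
  exact pow_eq_zero_iff (two_ne_zero) |>.1 hx

/-- Partial Fourier sums of an `L²` pairing are bounded uniformly in the truncation. -/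
theorem abs_sum_modePairing_le {L : ℝ} (hL : 0 < L) {g h : ℝ → ℝ} (hg : MemLp g 2 (perMeas L))
    (hh : MemLp h 2 (perMeas L)) (s : Finset ℤ) :
    |∑ k ∈ s, modePairing L g h k|
      ≤ L * ((∫ x, g x ^ 2 ∂(perMeas L)) + ∫ x, h x ^ 2 ∂(perMeas L)) := by
  have h1 := hasSum_sq_coeff hL hg
  have h2 := hasSum_sq_coeff hL hh
  have h3 := sum_le_hasSum s (fun k _ => by positivity) h1
  have h4 := sum_le_hasSum s (fun k _ => by positivity) h2
  rw [mul_add]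
  refine (Finset.abs_sum_le_sum_abs _ _).trans (le_trans ?_ (add_le_add h3 h4))
  rw [← Finset.sum_add_distrib]
  refine Finset.sum_le_sum fun k _ => ?_
  rw [modePairing]
  refine abs_le.2 ⟨?_, ?_⟩
  · nlinarith [sq_nonneg (cosCoeff L g k + cosCoeff L h k),
      sq_nonneg (sinCoeff L g k + sinCoeff L h k), sq_nonneg (cosCoeff L g k),
      sq_nonneg (sinCoeff L g k), sq_nonneg (cosCoeff L h k), sq_nonneg (sinCoeff L h k)]
  · nlinarith [sq_nonneg (cosCoeff L g k - cosCoeff L h k),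
      sq_nonneg (sinCoeff L g k - sinCoeff L h k), sq_nonneg (cosCoeff L g k),
      sq_nonneg (sinCoeff L g k), sq_nonneg (cosCoeff L h k), sq_nonneg (sinCoeff L h k)]

theorem freq_mul_add {L : ℝ} (hL : L ≠ 0) (k : ℤ) (x : ℝ) :
    freq L k * (x + L) = freq L k * x + k * (2 * Real.pi) := by
  rw [freq]; field_simp

theorem isTest_cos {L : ℝ} (hL : L ≠ 0) (k : ℤ) : IsTest L (fun x => Real.cos (freq L k * x)) where
  smooth := Real.contDiff_cos.comp (contDiff_const.mul contDiff_id)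
  periodic := fun x => by
    simp only [freq_mul_add hL, Real.cos_add_int_mul_two_pi]

theorem isTest_sin {L : ℝ} (hL : L ≠ 0) (k : ℤ) : IsTest L (fun x => Real.sin (freq L k * x)) where
  smooth := Real.contDiff_sin.comp (contDiff_const.mul contDiff_id)
  periodic := fun x => by
    simp only [freq_mul_add hL, Real.sin_add_int_mul_two_pi]

theorem deriv_cos_mul (a : ℝ) :
    deriv (fun x => Real.cos (a * x)) = fun x => -a * Real.sin (a * x) := by
  funext x
  have : HasDerivAt (fun x : ℝ => a * x) a x := by simpa using (hasDerivAt_id x).const_mul a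
  rw [this.cos.deriv]; ring

theorem deriv_sin_mul (a : ℝ) :
    deriv (fun x => Real.sin (a * x)) = fun x => a * Real.cos (a * x) := by
  funext x
  have : HasDerivAt (fun x : ℝ => a * x) a x := by simpa using (hasDerivAt_id x).const_mul a
  rw [this.sin.deriv]; ring

theorem integral_of_perMeas {L : ℝ} (hL : 0 < L) (g : ℝ → ℝ) :
    ∫ x, g x ∂(perMeas L) = ∫ x in (-(L / 2))..(L / 2), g x := by
  rw [intervalIntegral.integral_of_le (by linarith)]

/-- The integral of the derivative of a periodic function over a period vanishes. -/
theorem IsTest.integral_deriv {L : ℝ} (hL : 0 < L) {φ : ℝ → ℝ} (hφ : IsTest L φ) :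
    ∫ x, _root_.deriv φ x ∂(perMeas L) = 0 := by
  rw [integral_of_perMeas hL, intervalIntegral.integral_deriv_eq_sub
    (fun x _ => hφ.smooth.differentiable (by simp) x)
    (hφ.deriv.smooth.continuous.intervalIntegrable _ _)]
  rw [← hφ.periodic (-(L / 2))]
  ring_nf

theorem freq_ne_zero {L : ℝ} (hL : L ≠ 0) {k : ℤ} (hk : k ≠ 0) : freq L k ≠ 0 := by
  have := Real.pi_pos.ne'
  have hk' : (k : ℝ) ≠ 0 := by exact_mod_cast hk
  rw [freq]; positivity

theorem integral_cos_eq_zero {L : ℝ} (hL : 0 < L) {k : ℤ} (hk : k ≠ 0) :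
    ∫ x, Real.cos (freq L k * x) ∂(perMeas L) = 0 := by
  have h := (isTest_sin hL.ne' k).integral_deriv hL
  rw [deriv_sin_mul, integral_const_mul] at h
  exact (mul_eq_zero.1 h).resolve_left (freq_ne_zero hL.ne' hk)

theorem integral_sin_eq_zero {L : ℝ} (hL : 0 < L) {k : ℤ} (hk : k ≠ 0) :
    ∫ x, Real.sin (freq L k * x) ∂(perMeas L) = 0 := by
  have h := (isTest_cos hL.ne' k).integral_deriv hL
  rw [deriv_cos_mul, integral_const_mul] at h
  exact (mul_eq_zero.1 h).resolve_left (neg_ne_zero.2 (freq_ne_zero hL.ne' hk))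

/-- The Fourier coefficients of a weak derivative. -/
theorem HasWeakDeriv.cosCoeff_eq {L : ℝ} (hL : L ≠ 0) {g h : L2per L} (H : HasWeakDeriv g h)
    (k : ℤ) : cosCoeff L h k = freq L k * sinCoeff L g k := by
  have h1 := H _ (isTest_cos hL k)
  rw [deriv_cos_mul] at h1
  rw [cosCoeff, sinCoeff, ← integral_const_mul, ← neg_inj, ← h1, ← integral_neg]
  congr 1; funext x; ring

theorem HasWeakDeriv.sinCoeff_eq {L : ℝ} (hL : L ≠ 0) {g h : L2per L} (H : HasWeakDeriv g h)
    (k : ℤ) : sinCoeff L h k = -(freq L k * cosCoeff L g k) := by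
  have h1 := H _ (isTest_sin hL k)
  rw [deriv_sin_mul] at h1
  rw [cosCoeff, sinCoeff, ← integral_const_mul, ← neg_inj, neg_neg, ← h1]
  congr 1; funext x; ring

theorem norm_sq_L2per {L : ℝ} (g : L2per L) : ‖g‖ ^ 2 = ∫ x, g x ^ 2 ∂(perMeas L) := by
  rw [← real_inner_self_eq_norm_sq, L2.inner_def]
  simp only [real_inner_self_eq_norm_sq, Real.norm_eq_abs, sq_abs]

theorem inner_L2per {L : ℝ} (g h : L2per L) : inner ℝ g h = ∫ x, g x * h x ∂(perMeas L) := by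
  rw [L2.inner_def]
  refine integral_congr_ae (ae_of_all _ fun x => ?_)
  simp [mul_comm]

/-- **Wirtinger's inequality** with the sharp constant. -/
theorem wirtinger {L : ℝ} (hL : 0 < L) {g h : L2per L} (hg : g ∈ HSpace L)
    (H : HasWeakDeriv g h) : (2 * Real.pi / L) ^ 2 * ‖g‖ ^ 2 ≤ ‖h‖ ^ 2 := by
  rw [norm_sq_L2per, norm_sq_L2per]
  have h1 := (hasSum_sq_coeff hL (Lp.memLp g)).mul_left ((2 * Real.pi / L) ^ 2)
  have h2 := hasSum_sq_coeff hL (Lp.memLp h)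
  have h3 := hasSum_le (fun k => ?_) h1 h2
  · refine le_of_mul_le_mul_left ?_ hL
    linarith
  · rw [H.cosCoeff_eq hL.ne', H.sinCoeff_eq hL.ne']
    rcases eq_or_ne k 0 with rfl | hk
    · have : cosCoeff L g 0 = 0 := by
        rw [cosCoeff, freq]
        simpa using (show ∫ x, g x ∂(perMeas L) = 0 from hg)
      simp [this, freq, sinCoeff]
    · have hk' : (1 : ℝ) ≤ (k : ℝ) ^ 2 := by
        have : 1 ≤ k ^ 2 := by have := sq_pos_of_ne_zero hk; omega
        exact_mod_cast this
      have : (2 * Real.pi / L) ^ 2 ≤ freq L k ^ 2 := by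
        have : freq L k ^ 2 = (2 * Real.pi / L) ^ 2 * (k : ℝ) ^ 2 := by rw [freq]; ring
        rw [this]
        exact le_mul_of_one_le_right (sq_nonneg _) hk'
      have h0 : 0 ≤ cosCoeff L g k ^ 2 + sinCoeff L g k ^ 2 := by positivity
      nlinarith [mul_le_mul_of_nonneg_right this h0]

/-! ### The space `V` -/

/-- The Cauchy–Schwarz inequality for square integrable functions. -/
theorem sq_integral_mul_le {α : Type*} [MeasurableSpace α] {μ : Measure α} {f g : α → ℝ}
    (hf : MemLp f 2 μ) (hg : MemLp g 2 μ) :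
    (∫ x, f x * g x ∂μ) ^ 2 ≤ (∫ x, f x ^ 2 ∂μ) * ∫ x, g x ^ 2 ∂μ := by
  have key : ∀ {f g : α → ℝ} (hf : MemLp f 2 μ) (hg : MemLp g 2 μ),
      inner ℝ (hf.toLp f) (hg.toLp g) = ∫ x, f x * g x ∂μ := by
    intro f g hf hg
    rw [L2.inner_def]
    refine integral_congr_ae ?_
    filter_upwards [hf.coeFn_toLp, hg.coeFn_toLp] with x h1 h2
    rw [h1, h2]
    simp [mul_comm]
  have h := real_inner_mul_inner_self_le (hf.toLp f) (hg.toLp g)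
  rw [key hf hg, key hf hf, key hg hg] at h
  simpa only [sq] using h

theorem HasWeakDeriv.integral_eq_zero {L : ℝ} {g h : L2per L}
    (H : HasWeakDeriv g h) : ∫ x, h x ∂(perMeas L) = 0 := by
  have h1 := H (fun _ => 1) ⟨contDiff_const, fun x => rfl⟩
  simp at h1
  exact h1

theorem L2per.intervalIntegrable {L : ℝ} (hL : 0 < L) (h : L2per L) :
    IntervalIntegrable (fun x => h x) volume (-(L / 2)) (L / 2) :=
  (intervalIntegrable_iff_integrableOn_Ioc_of_le (by linarith)).2 h.integrable

/-- The primitive, vanishing at the left end of the period, of an element of `L²_per(𝕋)`. -/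
noncomputable def primitive {L : ℝ} (h : L2per L) (x : ℝ) : ℝ := ∫ t in (-(L / 2))..x, h t

theorem primitive_ac {L : ℝ} (hL : 0 < L) (h : L2per L) :
    AbsolutelyContinuousOnInterval (primitive h) (-(L / 2)) (L / 2) :=
  (h.intervalIntegrable hL).absolutelyContinuousOnInterval_intervalIntegral left_mem_uIcc

theorem primitive_left {L : ℝ} (h : L2per L) : primitive h (-(L / 2)) = 0 := by
  simp [primitive]

theorem HasWeakDeriv.primitive_right {L : ℝ} (hL : 0 < L) {g h : L2per L}
    (H : HasWeakDeriv g h) : primitive h (L / 2) = 0 := by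
  rw [primitive, ← integral_of_perMeas hL, H.integral_eq_zero]

theorem ae_hasDerivAt_primitive {L : ℝ} (hL : 0 < L) (h : L2per L) :
    ∀ᵐ x ∂(perMeas L), HasDerivAt (primitive h) (h x) x := by
  rw [ae_restrict_iff' measurableSet_Ioc]
  filter_upwards [(h.intervalIntegrable hL).ae_hasDerivAt_integral] with x hx hxI
  refine hx ?_ _ left_mem_uIcc
  rw [uIcc_of_le (by linarith)]
  exact Ioc_subset_Icc_self hxI

theorem memLp_of_ac {L : ℝ} (hL : 0 < L) {W : ℝ → ℝ}
    (hW : AbsolutelyContinuousOnInterval W (-(L / 2)) (L / 2)) : MemLp W 2 (perMeas L) := by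
  have hc : ContinuousOn W (Icc (-(L / 2)) (L / 2)) := by
    have := hW.continuousOn
    rwa [uIcc_of_le (by linarith)] at this
  obtain ⟨C, hC⟩ := isCompact_Icc.exists_bound_of_continuousOn hc
  refine MemLp.of_bound ((hc.mono Ioc_subset_Icc_self).aestronglyMeasurable measurableSet_Ioc) C ?_
  filter_upwards [ae_restrict_mem measurableSet_Ioc] with x hx
  exact hC x (Ioc_subset_Icc_self hx)

/-- A function with a weak derivative is, up to a constant, the primitive of that derivative:
the difference has vanishing Fourier coefficients except the zeroth. -/
theorem HasWeakDeriv.exists_ae_eq_primitive {L : ℝ} (hL : 0 < L) {g h : L2per L}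
    (H : HasWeakDeriv g h) : ∃ c : ℝ, ∀ᵐ x ∂(perMeas L), g x = c + primitive h x := by
  have hle : -(L / 2) ≤ L / 2 := by linarith
  have hW := primitive_ac hL h
  have hWm := memLp_of_ac hL hW
  have hD : MemLp (fun x => g x - primitive h x) 2 (perMeas L) := (Lp.memLp g).sub hWm
  have hparts : ∀ ψ : ℝ → ℝ, IsTest L ψ →
      ∫ x, (g x - primitive h x) * deriv ψ x ∂(perMeas L) = 0 := by
    intro ψ hψ
    have hψac : AbsolutelyContinuousOnInterval ψ (-(L / 2)) (L / 2) :=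
      ((hψ.smooth.of_le (by simp)).contDiffOn).absolutelyContinuousOnInterval
    have h1 := hW.integral_mul_deriv_eq_deriv_mul hψac
    rw [H.primitive_right hL, primitive_left, zero_mul, zero_mul, sub_zero, zero_sub,
      ← integral_of_perMeas hL, ← integral_of_perMeas hL] at h1
    have h2 : ∫ x, deriv (primitive h) x * ψ x ∂(perMeas L) = ∫ x, h x * ψ x ∂(perMeas L) := by
      refine integral_congr_ae ?_
      filter_upwards [ae_hasDerivAt_primitive hL h] with x hx
      rw [hx.deriv]
    have hWi : Integrable (fun x => primitive h x * deriv ψ x) (perMeas L) :=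
      hWm.integrable_mul hψ.deriv.memLp
    simp only [sub_mul]
    rw [integral_sub (g.integrable_mul hψ.deriv) hWi, H ψ hψ, h1,
      h2, sub_self]
  set c := (1 / L) * ∫ x, (g x - primitive h x) ∂(perMeas L) with hc
  refine ⟨c, ?_⟩
  have hDi := hD.integrable (by norm_num : (1 : ENNReal) ≤ 2)
  have key := ae_eq_zero_of_coeff_eq_zero hL
    (g := fun x => (g x - primitive h x) - c) (hD.sub (memLp_const c)) (fun k => ?_)
  · filter_upwards [key] with x hx
    simp only [Pi.zero_apply] at hx
    linarith
  · have hcos : Integrable (fun x => (g x - primitive h x) * Real.cos (freq L k * x)) (perMeas L) :=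
      hDi.mul_bdd (c := 1) (by fun_prop) (ae_of_all _ fun x => Real.abs_cos_le_one _)
    have hsin : Integrable (fun x => (g x - primitive h x) * Real.sin (freq L k * x)) (perMeas L) :=
      hDi.mul_bdd (c := 1) (by fun_prop) (ae_of_all _ fun x => Real.abs_sin_le_one _)
    simp only [cosCoeff, sinCoeff, sub_mul _ c]
    rw [integral_sub hcos ((isTest_cos hL.ne' k).memLp.integrable (by norm_num) |>.const_mul c),
      integral_sub hsin ((isTest_sin hL.ne' k).memLp.integrable (by norm_num) |>.const_mul c),
      integral_const_mul, integral_const_mul]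
    rcases eq_or_ne k 0 with rfl | hk
    · have e : (perMeas L).real univ = L := by
        simp only [measureReal_restrict_apply_univ, Real.volume_real_Ioc]
        rw [max_eq_left] <;> linarith
      simp only [freq, Int.cast_zero, mul_zero, zero_div, zero_mul, Real.cos_zero, mul_one,
        Real.sin_zero, integral_zero, sub_zero, integral_const, e, smul_eq_mul, and_true]
      rw [hc]
      field_simp
      ring
    · have h1 := hparts _ (isTest_sin hL.ne' k)
      have h2 := hparts _ (isTest_cos hL.ne' k)
      rw [deriv_sin_mul] at h1
      rw [deriv_cos_mul] at h2
      simp only [mul_left_comm _ (freq L k), mul_left_comm _ (-freq L k)] at h1 h2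
      rw [integral_const_mul] at h1 h2
      have h1' := (mul_eq_zero.1 h1).resolve_left (freq_ne_zero hL.ne' hk)
      have h2' := (mul_eq_zero.1 h2).resolve_left (neg_ne_zero.2 (freq_ne_zero hL.ne' hk))
      rw [h1', h2', integral_cos_eq_zero hL hk, integral_sin_eq_zero hL hk]
      simp

theorem sq_setIntegral_le {L : ℝ} (h : L2per L) {s : Set ℝ} (hs : MeasurableSet s) :
    (∫ x in s, h x ∂(perMeas L)) ^ 2 ≤ (perMeas L).real s * ‖h‖ ^ 2 := by
  have hm : MemLp (s.indicator fun _ => (1 : ℝ)) 2 (perMeas L) := (memLp_const 1).indicator hs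
  have h1 := sq_integral_mul_le hm (Lp.memLp h)
  have e1 : ∫ x, s.indicator (fun _ => (1 : ℝ)) x * h x ∂(perMeas L)
      = ∫ x in s, h x ∂(perMeas L) := by
    rw [← integral_indicator hs]
    congr 1; funext x
    by_cases hx : x ∈ s <;> simp [hx]
  have e2 : ∫ x, s.indicator (fun _ => (1 : ℝ)) x ^ 2 ∂(perMeas L) = (perMeas L).real s := by
    have : (fun x => s.indicator (fun _ => (1 : ℝ)) x ^ 2) = s.indicator (fun _ => (1 : ℝ)) := by
      funext x
      by_cases hx : x ∈ s <;> simp [hx]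
    rw [this, integral_indicator hs]
    simp
  rwa [e1, e2, ← norm_sq_L2per] at h1

/-- Hölder continuity of elements of `H¹_per` with respect to the distance of the torus. -/
theorem HasWeakDeriv.sq_primitive_sub_le {L : ℝ} (hL : 0 < L) {g h : L2per L}
    (H : HasWeakDeriv g h) {x y : ℝ} (hx : x ∈ Icc (-(L / 2)) (L / 2))
    (hy : y ∈ Icc (-(L / 2)) (L / 2)) :
    (primitive h y - primitive h x) ^ 2 ≤ min |x - y| (L - |x - y|) * ‖h‖ ^ 2 := by
  wlog hxy : x ≤ y generalizing x y
  · have := this hy hx (by linarith)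
    rwa [abs_sub_comm, ← sub_sq_comm] at this
  rw [abs_sub_comm, abs_of_nonneg (sub_nonneg.2 hxy)]
  have hI := h.intervalIntegrable hL
  have hle : -(L / 2) ≤ L / 2 := by linarith
  have hmeas : (perMeas L).real (Ioc x y) = y - x := by
    rw [measureReal_restrict_apply measurableSet_Ioc,
      inter_eq_left.2 (Ioc_subset_Ioc hx.1 hy.2), Real.volume_real_Ioc_of_le hxy]
  have hdiff : primitive h y - primitive h x = ∫ t in Ioc x y, h t ∂(perMeas L) := by
    rw [primitive, primitive, intervalIntegral.integral_interval_sub_left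
      (hI.mono_set (by rw [uIcc_of_le hle, uIcc_of_le hy.1]; exact Icc_subset_Icc_right hy.2))
      (hI.mono_set (by rw [uIcc_of_le hle, uIcc_of_le hx.1]; exact Icc_subset_Icc_right hx.2)),
      intervalIntegral.integral_of_le hxy, Measure.restrict_restrict measurableSet_Ioc,
      inter_eq_left.2 (Ioc_subset_Ioc hx.1 hy.2)]
  rw [min_mul_of_nonneg _ _ (sq_nonneg _)]
  refine le_min ?_ ?_
  · rw [hdiff, ← hmeas]
    exact sq_setIntegral_le h measurableSet_Ioc
  · have hcompl := integral_add_compl (measurableSet_Ioc (a := x) (b := y)) h.integrable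
    rw [H.integral_eq_zero, ← hdiff] at hcompl
    have e : primitive h y - primitive h x = -∫ t in (Ioc x y)ᶜ, h t ∂(perMeas L) := by linarith
    have hm2 : (perMeas L).real (Ioc x y)ᶜ = L - (y - x) := by
      rw [measureReal_compl measurableSet_Ioc, hmeas, measureReal_restrict_apply_univ,
        Real.volume_real_Ioc_of_le hle]
      ring
    rw [e, neg_sq, ← hm2]
    exact sq_setIntegral_le h measurableSet_Ioc.compl

/-- A function in `H¹_per` is close to its average against a probability density
on the support of that density, if this support is small. -/
theorem HasWeakDeriv.ae_sq_sub_average_le {L : ℝ} (hL : 0 < L) {g h : L2per L}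
    (H : HasWeakDeriv g h) {δ : ℝ → ℝ} (hδ : MemLp δ 2 (perMeas L)) (hδ0 : ∀ x, 0 ≤ δ x)
    (hδ1 : ∫ x, δ x ∂(perMeas L) = 1) {r : ℝ}
    (hr : ∀ x ∈ Ioc (-(L / 2)) (L / 2), ∀ y ∈ Ioc (-(L / 2)) (L / 2), δ x ≠ 0 → δ y ≠ 0 →
      min |x - y| (L - |x - y|) ≤ r) :
    ∀ᵐ x ∂(perMeas L), δ x ≠ 0 → (g x - ∫ y, g y * δ y ∂(perMeas L)) ^ 2 ≤ r * ‖h‖ ^ 2 := by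
  obtain ⟨c, hc⟩ := H.exists_ae_eq_primitive hL
  have hi : Integrable (fun x => g x * δ x) (perMeas L) := (Lp.memLp g).integrable_mul hδ
  have hδi := hδ.integrable (by norm_num : (1 : ENNReal) ≤ 2)
  filter_upwards [hc, ae_restrict_mem measurableSet_Ioc] with x hx hxI hδx
  have hr0 : 0 ≤ r := by
    refine le_trans (le_min (abs_nonneg _) ?_) (hr x hxI x hxI hδx hδx)
    simp [hL.le]
  have e : g x - ∫ y, g y * δ y ∂(perMeas L) = ∫ y, (g x - g y) * δ y ∂(perMeas L) := by
    simp only [sub_mul]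
    rw [integral_sub (hδi.const_mul _) hi, integral_const_mul, hδ1, mul_one]
  have hb : ∀ᵐ y ∂(perMeas L), ‖(g x - g y) * δ y‖ ≤ √(r * ‖h‖ ^ 2) * δ y := by
    filter_upwards [hc, ae_restrict_mem measurableSet_Ioc] with y hy hyI
    rw [norm_mul, Real.norm_eq_abs, Real.norm_eq_abs, abs_of_nonneg (hδ0 y)]
    rcases eq_or_ne (δ y) 0 with h0 | h0
    · simp [h0]
    · refine mul_le_mul_of_nonneg_right (Real.abs_le_sqrt ?_) (hδ0 y)
      rw [hx, hy, add_sub_add_left_eq_sub]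
      refine (H.sq_primitive_sub_le hL (Ioc_subset_Icc_self hyI) (Ioc_subset_Icc_self hxI)).trans ?_
      exact mul_le_mul_of_nonneg_right (hr y hyI x hxI h0 hδx) (sq_nonneg _)
  have h1 := norm_integral_le_of_norm_le (hδi.const_mul _) hb
  rw [integral_const_mul, hδ1, mul_one, ← e, Real.norm_eq_abs] at h1
  calc _ = |g x - ∫ y, g y * δ y ∂(perMeas L)| ^ 2 := (sq_abs _).symm
    _ ≤ √(r * ‖h‖ ^ 2) ^ 2 := by gcongr
    _ = r * ‖h‖ ^ 2 := Real.sq_sqrt (by positivity)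

theorem integrable_sq_mul {L : ℝ} (g : L2per L) {χ : ℝ → ℝ} (hχ : Continuous χ) :
    Integrable (fun x => g x ^ 2 * χ x) (perMeas L) := by
  obtain ⟨C, hC⟩ := (isCompact_Icc (a := -(L / 2)) (b := L / 2)).exists_bound_of_continuousOn
    hχ.continuousOn
  refine (Lp.memLp g).integrable_sq.mul_bdd (c := C) hχ.aestronglyMeasurable ?_
  filter_upwards [ae_restrict_mem measurableSet_Ioc] with x hx
  exact hC x (Ioc_subset_Icc_self hx)

/-- The weighted Poincaré inequality for a concentrated probability density. -/
theorem HasWeakDeriv.integral_sq_mul_le {L : ℝ} (hL : 0 < L) {g h : L2per L}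
    (H : HasWeakDeriv g h) {δ : ℝ → ℝ} (hδ : Continuous δ) (hδ0 : ∀ x, 0 ≤ δ x)
    (hδ1 : ∫ x, δ x ∂(perMeas L) = 1) {r : ℝ}
    (hr : ∀ x ∈ Ioc (-(L / 2)) (L / 2), ∀ y ∈ Ioc (-(L / 2)) (L / 2), δ x ≠ 0 → δ y ≠ 0 →
      min |x - y| (L - |x - y|) ≤ r) :
    ∫ x, g x ^ 2 * δ x ∂(perMeas L)
      ≤ (∫ x, g x * δ x ∂(perMeas L)) ^ 2 + r * ‖h‖ ^ 2 := by
  have hδm := memLp_of_continuous (L := L) hδ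
  have hδi := hδm.integrable (by norm_num : (1 : ENNReal) ≤ 2)
  have hgi := (Lp.memLp g).integrable_mul hδm
  set m := ∫ x, g x * δ x ∂(perMeas L) with hm
  have key : ∫ x, g x ^ 2 * δ x ∂(perMeas L)
      ≤ ∫ x, (2 * m * (g x * δ x) + (r * ‖h‖ ^ 2 - m ^ 2) * δ x) ∂(perMeas L) := by
    refine integral_mono_ae (integrable_sq_mul g hδ)
      ((hgi.const_mul _).add (hδi.const_mul _)) ?_
    filter_upwards [H.ae_sq_sub_average_le hL hδm hδ0 hδ1 hr] with x hx
    rcases eq_or_ne (δ x) 0 with h0 | h0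
    · simp [h0]
    · nlinarith [mul_le_mul_of_nonneg_right (hx h0) (hδ0 x)]
  refine key.trans (le_of_eq ?_)
  have e := integral_add (hgi.const_mul (2 * m)) (hδi.const_mul (r * ‖h‖ ^ 2 - m ^ 2))
  simp only [Pi.mul_apply] at e
  rw [e, integral_const_mul, integral_const_mul, hδ1, ← hm]
  ring

theorem HasWeakDeriv.ae_sq_le {L : ℝ} (hL : 0 < L) {g h : L2per L} (hg : g ∈ HSpace L)
    (H : HasWeakDeriv g h) : ∀ᵐ x ∂(perMeas L), g x ^ 2 ≤ L * ‖h‖ ^ 2 := by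
  have hm : (perMeas L).real univ = L := by
    rw [measureReal_restrict_apply_univ, Real.volume_real_Ioc_of_le (by linarith)]
    ring
  have h1 := H.ae_sq_sub_average_le hL (δ := fun _ => 1 / L) (memLp_const _)
    (fun _ => by positivity)
    (by rw [integral_const, hm, smul_eq_mul]; field_simp) (r := L)
    (fun x _ y _ _ _ => (min_le_right _ _).trans (by linarith [abs_nonneg (x - y)]))
  filter_upwards [h1] with x hx
  have h2 := hx (by positivity)
  rwa [integral_mul_const, show ∫ x, g x ∂(perMeas L) = 0 from hg, zero_mul, sub_zero] at h2

theorem HasWeakDeriv.memLp_sq {L : ℝ} (hL : 0 < L) {g h : L2per L} (hg : g ∈ HSpace L)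
    (H : HasWeakDeriv g h) : MemLp (fun x => g x ^ 2) 2 (perMeas L) := by
  refine MemLp.of_bound ((Lp.memLp g).aestronglyMeasurable.pow 2) (L * ‖h‖ ^ 2) ?_
  filter_upwards [H.ae_sq_le hL hg] with x hx
  rwa [Real.norm_of_nonneg (sq_nonneg _)]

theorem HasWeakDeriv.integral_pow_four_le {L : ℝ} (hL : 0 < L) {g h : L2per L} (hg : g ∈ HSpace L)
    (H : HasWeakDeriv g h) :
    ∫ x, (g x ^ 2) ^ 2 ∂(perMeas L) ≤ L * ‖h‖ ^ 2 * ‖g‖ ^ 2 := by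
  rw [norm_sq_L2per g, ← integral_const_mul]
  refine integral_mono_ae (H.memLp_sq hL hg).integrable_sq
    ((Lp.memLp g).integrable_sq.const_mul _) ?_
  filter_upwards [H.ae_sq_le hL hg] with x hx
  rw [sq (g x ^ 2)]
  exact mul_le_mul_of_nonneg_right hx (sq_nonneg _)

/-- The nonlinear term does no work: `∫ u² u_x = 0`. -/
theorem HasWeakDeriv.integral_sq_mul_deriv {L : ℝ} (hL : 0 < L) {g h : L2per L}
    (H : HasWeakDeriv g h) : ∫ x, g x ^ 2 * h x ∂(perMeas L) = 0 := by
  obtain ⟨c, hc⟩ := H.exists_ae_eq_primitive hL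
  have hU : AbsolutelyContinuousOnInterval (fun x => c + primitive h x) (-(L / 2)) (L / 2) :=
    AbsolutelyContinuousOnInterval.add
      ((contDiff_const (c := c) (n := 1)).contDiffOn).absolutelyContinuousOnInterval
      (primitive_ac hL h)
  have h1 := ((hU.fun_mul hU).fun_mul hU).integral_deriv_eq_sub
  rw [H.primitive_right hL, primitive_left, sub_self, ← integral_of_perMeas hL] at h1
  have h2 : ∫ x, 3 * (g x ^ 2 * h x) ∂(perMeas L) = 0 := by
    rw [← h1]
    refine integral_congr_ae ?_
    filter_upwards [hc, ae_hasDerivAt_primitive hL h] with x hx hd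
    have hd' := hd.const_add c
    rw [((hd'.fun_mul hd').fun_mul hd').deriv, hx]
    ring
  rw [integral_const_mul] at h2
  linarith

/-! ### Regularity in time of weak solutions -/

theorem continuous_integral_mul {L : ℝ} {χ : ℝ → ℝ} (hχ : MemLp χ 2 (perMeas L)) :
    Continuous fun g : L2per L => ∫ x, g x * χ x ∂(perMeas L) := by
  have e : (fun g : L2per L => ∫ x, g x * χ x ∂(perMeas L))
      = fun g : L2per L => inner ℝ g (hχ.toLp χ) := by
    funext g
    rw [inner_L2per]
    refine integral_congr_ae ?_
    filter_upwards [hχ.coeFn_toLp] with x hx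
    rw [hx]
  rw [e]
  fun_prop

theorem continuous_integral_sq_mul {L : ℝ} {χ : ℝ → ℝ} (hχ : Continuous χ) :
    Continuous fun g : L2per L => ∫ x, g x ^ 2 * χ x ∂(perMeas L) := by
  obtain ⟨C, hC⟩ := (isCompact_Icc (a := -(L / 2)) (b := L / 2)).exists_bound_of_continuousOn
    hχ.continuousOn
  have key : ∀ g h : L2per L, |(∫ x, h x ^ 2 * χ x ∂(perMeas L)) - ∫ x, g x ^ 2 * χ x ∂(perMeas L)|
      ≤ ‖h - g‖ * (|C| * ‖h + g‖) := by
    intro g h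
    have hm : MemLp (fun x => (h + g : L2per L) x * χ x) 2 (perMeas L) := by
      refine (Lp.memLp (h + g)).of_le_mul (c := |C|)
        ((Lp.memLp _).aestronglyMeasurable.mul hχ.aestronglyMeasurable) ?_
      filter_upwards [ae_restrict_mem measurableSet_Ioc] with x hx
      rw [norm_mul, mul_comm]
      exact mul_le_mul_of_nonneg_right ((hC x (Ioc_subset_Icc_self hx)).trans (le_abs_self C))
        (norm_nonneg _)
    have e1 : (∫ x, h x ^ 2 * χ x ∂(perMeas L)) - ∫ x, g x ^ 2 * χ x ∂(perMeas L)
        = ∫ x, (h - g : L2per L) x * ((h + g : L2per L) x * χ x) ∂(perMeas L) := by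
      rw [← integral_sub (integrable_sq_mul h hχ) (integrable_sq_mul g hχ)]
      refine integral_congr_ae ?_
      filter_upwards [Lp.coeFn_sub h g, Lp.coeFn_add h g] with x h1 h2
      rw [h1, h2, Pi.sub_apply, Pi.add_apply]
      ring
    have e2 : ∫ x, ((h + g : L2per L) x * χ x) ^ 2 ∂(perMeas L) ≤ (|C| * ‖h + g‖) ^ 2 := by
      rw [mul_pow, norm_sq_L2per, ← integral_const_mul]
      refine integral_mono_ae hm.integrable_sq ((Lp.memLp _).integrable_sq.const_mul _) ?_
      filter_upwards [ae_restrict_mem measurableSet_Ioc] with x hx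
      have : χ x ^ 2 ≤ |C| ^ 2 := by
        rw [← sq_abs (χ x)]
        exact pow_le_pow_left₀ (abs_nonneg _)
          ((hC x (Ioc_subset_Icc_self hx)).trans (le_abs_self C)) 2
      simp only [mul_pow]
      rw [mul_comm]
      exact mul_le_mul_of_nonneg_right this (sq_nonneg _)
    rw [e1]
    refine abs_le_of_sq_le_sq ?_ (by positivity)
    refine (sq_integral_mul_le (Lp.memLp (h - g)) hm).trans ?_
    rw [mul_pow, norm_sq_L2per (h - g)]
    exact mul_le_mul_of_nonneg_left e2 (integral_nonneg fun x => sq_nonneg _)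
  rw [continuous_iff_continuousAt]
  intro g
  rw [ContinuousAt, tendsto_iff_dist_tendsto_zero]
  refine squeeze_zero (fun _ => dist_nonneg) (fun h => key g h) ?_
  have : Continuous fun h : L2per L => ‖h - g‖ * (|C| * ‖h + g‖) := by fun_prop
  simpa using this.tendsto g

/-- The right-hand side of the weak formulation, i.e. the time derivative of the pairing of a
solution with the test function `φ`, when the solution takes the value `g`. -/
noncomputable def weakRHS {L : ℝ} (ν β γ : ℝ) (f : VDual L) {φ : ℝ → ℝ} (hφ : IsTest L φ)
    (h0 : ∫ x, φ x ∂(perMeas L) = 0) (g : L2per L) : ℝ :=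
  ν * (∫ x, g x * iteratedDeriv 2 φ x ∂(perMeas L))
    + (1 / 2) * (∫ x, g x ^ 2 * deriv φ x ∂(perMeas L))
    + β * (∫ x, g x * φ x ∂(perMeas L))
    + γ * (∫ x, g x * iteratedDeriv 3 φ x ∂(perMeas L))
    + f (testV φ hφ h0)

theorem IsTest.iteratedDeriv {L : ℝ} {φ : ℝ → ℝ} (hφ : IsTest L φ) (n : ℕ) :
    IsTest L (iteratedDeriv n φ) := by
  induction n with
  | zero => simpa using hφ
  | succ n ih => rw [iteratedDeriv_succ]; exact ih.deriv

theorem continuous_weakRHS {L : ℝ} (ν β γ : ℝ) (f : VDual L) {φ : ℝ → ℝ} (hφ : IsTest L φ)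
    (h0 : ∫ x, φ x ∂(perMeas L) = 0) : Continuous (weakRHS ν β γ f hφ h0) := by
  have h1 := continuous_integral_mul (hφ.iteratedDeriv 2).memLp
  have h2 := continuous_integral_mul (hφ.iteratedDeriv 3).memLp
  have h3 := continuous_integral_mul hφ.memLp
  have h4 := continuous_integral_sq_mul (L := L) hφ.deriv.smooth.continuous
  unfold weakRHS
  fun_prop

theorem IsSolution.continuousOn_coe {L ν β γ : ℝ} {f : VDual L} {u₀ : HSpace L} {u : ℝ → HSpace L}
    (hu : IsSolution ν β γ f u₀ u) : ContinuousOn (fun t => (u t : L2per L)) (Ici 0) :=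
  continuous_subtype_val.comp_continuousOn hu.continuousOn

theorem IsSolution.continuousOn_weakRHS {L ν β γ : ℝ} {f : VDual L} {u₀ : HSpace L}
    {u : ℝ → HSpace L} (hu : IsSolution ν β γ f u₀ u) {φ : ℝ → ℝ} (hφ : IsTest L φ)
    (h0 : ∫ x, φ x ∂(perMeas L) = 0) :
    ContinuousOn (fun τ => weakRHS ν β γ f hφ h0 (u τ)) (Ici 0) :=
  (continuous_weakRHS ν β γ f hφ h0).comp_continuousOn hu.continuousOn_coe

theorem intervalIntegrable_of_continuousOn_Ici {F : ℝ → ℝ} (hF : ContinuousOn F (Ici 0)) {s t : ℝ}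
    (hs : 0 ≤ s) (ht : 0 ≤ t) : IntervalIntegrable F volume s t :=
  (hF.mono fun _ hx => (le_min hs ht).trans hx.1).intervalIntegrable

/-- The weak formulation between two arbitrary times. Continuity in time makes the integrand
integrable, so that the two time integrals may be subtracted. -/
theorem IsSolution.pairing_sub {L ν β γ : ℝ} {f : VDual L} {u₀ : HSpace L}
    {u : ℝ → HSpace L} (hu : IsSolution ν β γ f u₀ u) {φ : ℝ → ℝ} (hφ : IsTest L φ)
    (h0 : ∫ x, φ x ∂(perMeas L) = 0) {s t : ℝ} (hs : 0 ≤ s) (ht : 0 ≤ t) :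
    (∫ x, (u t : L2per L) x * φ x ∂(perMeas L)) - ∫ x, (u s : L2per L) x * φ x ∂(perMeas L)
      = ∫ τ in s..t, weakRHS ν β γ f hφ h0 (u τ) := by
  have h1 := hu.weak_eq φ hφ h0 t ht
  have h2 := hu.weak_eq φ hφ h0 s hs
  have hc := hu.continuousOn_weakRHS hφ h0
  have h3 := intervalIntegral.integral_interval_sub_left
    (intervalIntegrable_of_continuousOn_Ici hc le_rfl ht)
    (intervalIntegrable_of_continuousOn_Ici hc le_rfl hs)
  rw [← h3]
  simp only [weakRHS]
  linarith

/-- The fundamental theorem of calculus for the square of a primitive of `p`. -/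
theorem sq_sub_sq_eq_integral {F p : ℝ → ℝ} (hp : ContinuousOn p (Ici 0))
    (hF : ∀ s t, 0 ≤ s → 0 ≤ t → F t - F s = ∫ τ in s..t, p τ) {s t : ℝ} (hs : 0 ≤ s)
    (hst : s ≤ t) : F t ^ 2 - F s ^ 2 = ∫ τ in s..t, 2 * (F τ * p τ) := by
  have hFeq : ∀ r ∈ Ici (0 : ℝ), F r = F 0 + ∫ τ in (0 : ℝ)..r, p τ := fun r hr => by
    have := hF 0 r le_rfl hr
    linarith
  have hd : ∀ r, 0 < r → HasDerivAt F (p r) r := by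
    intro r hr
    have h1 : HasDerivAt (fun r => F 0 + ∫ τ in (0 : ℝ)..r, p τ) (p r) r := by
      refine (intervalIntegral.integral_hasDerivAt_right
        (intervalIntegrable_of_continuousOn_Ici hp le_rfl hr.le) ?_
        (hp.continuousAt (Ici_mem_nhds hr))).const_add _
      exact ContinuousOn.stronglyMeasurableAtFilter_nhdsWithin hp measurableSet_Ici r |>.filter_mono
        (by rw [nhdsWithin_eq_nhds.2 (Ici_mem_nhds hr)])
    refine h1.congr_of_eventuallyEq ?_
    filter_upwards [Ici_mem_nhds hr] with x hx using hFeq x hx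
  have hFc : ContinuousOn F (Ici 0) := by
    intro r hr
    have h1 : ContinuousOn (fun r => ∫ τ in (0 : ℝ)..r, p τ) (Icc 0 (r + 1)) := by
      have hr0 : (0 : ℝ) ≤ r + 1 := by linarith [mem_Ici.1 hr]
      have := intervalIntegral.continuousOn_primitive_interval'
        (intervalIntegrable_of_continuousOn_Ici hp le_rfl hr0) left_mem_uIcc
      rwa [uIcc_of_le hr0] at this
    have h2 : ContinuousWithinAt F (Icc 0 (r + 1)) r :=
      ((h1.const_add (F 0)).congr fun x hx => hFeq x hx.1) r ⟨hr, by linarith⟩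
    refine h2.mono_of_mem_nhdsWithin ?_
    rw [← Ici_inter_Iic]
    exact inter_mem self_mem_nhdsWithin (mem_nhdsWithin_of_mem_nhds (Iic_mem_nhds (by linarith)))
  symm
  refine intervalIntegral.integral_eq_sub_of_hasDerivAt_of_le hst
    (f := fun r => F r ^ 2) ((hFc.pow 2).mono fun x hx => hs.trans hx.1) (fun r hr => ?_) ?_
  · convert! (hd r (hs.trans_lt hr.1)).fun_pow 2 using 1
    push_cast; ring
  · exact intervalIntegrable_of_continuousOn_Ici (continuousOn_const.mul (hFc.mul hp)) hs
      (hs.trans hst)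

/-- Elements of `V'` are represented by pairs of `L²` functions: extend by Hahn–Banach from `V`
to the Hilbert space of all pairs, and apply the Riesz representation theorem there. -/
theorem exists_representation {L : ℝ} (f : VDual L) : ∃ w₁ w₂ : L2per L, ∀ p : VSpace L,
    f p = (∫ x, (p : WithLp 2 (L2per L × L2per L)).fst x * w₁ x ∂(perMeas L))
      + ∫ x, (p : WithLp 2 (L2per L × L2per L)).snd x * w₂ x ∂(perMeas L) := by
  obtain ⟨g, hg, -⟩ := exists_extension_norm_eq (𝕜 := ℝ) (VSpace L) f
  set w := (InnerProductSpace.toDual ℝ (WithLp 2 (L2per L × L2per L))).symm g with hw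
  refine ⟨w.fst, w.snd, fun p => ?_⟩
  rw [← hg p, ← inner_L2per, ← inner_L2per, real_inner_comm, real_inner_comm w.snd]
  exact (InnerProductSpace.toDual_symm_apply (𝕜 := ℝ)).symm.trans (WithLp.prod_inner_apply w p)

/-! ### The energy equality -/

theorem cosCoeff_zero {L : ℝ} {g : L2per L} (hg : g ∈ HSpace L) : cosCoeff L g 0 = 0 := by
  rw [cosCoeff, freq]
  simpa using (show ∫ x, g x ∂(perMeas L) = 0 from hg)

theorem sinCoeff_zero (L : ℝ) (g : ℝ → ℝ) : sinCoeff L g 0 = 0 := by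
  simp [sinCoeff, freq]

theorem apply_testV {L : ℝ} {f : VDual L} {w₁ w₂ : L2per L}
    (hf : ∀ p : VSpace L, f p
      = (∫ x, (p : WithLp 2 (L2per L × L2per L)).fst x * w₁ x ∂(perMeas L))
        + ∫ x, (p : WithLp 2 (L2per L × L2per L)).snd x * w₂ x ∂(perMeas L))
    {φ : ℝ → ℝ} (hφ : IsTest L φ) (h0 : ∫ x, φ x ∂(perMeas L) = 0) :
    f (testV φ hφ h0) = (∫ x, w₁ x * φ x ∂(perMeas L)) + ∫ x, w₂ x * deriv φ x ∂(perMeas L) := by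
  rw [hf]
  congr 1
  · refine integral_congr_ae ?_
    filter_upwards [hφ.memLp.coeFn_toLp] with x hx
    rw [mul_comm]
    exact congrArg _ hx
  · refine integral_congr_ae ?_
    filter_upwards [hφ.deriv.memLp.coeFn_toLp] with x hx
    rw [mul_comm]
    exact congrArg _ hx

theorem iteratedDeriv_two_cos (a : ℝ) :
    iteratedDeriv 2 (fun x => Real.cos (a * x)) = fun x => -a ^ 2 * Real.cos (a * x) := by
  rw [iteratedDeriv_succ, iteratedDeriv_one, deriv_cos_mul]
  funext x
  rw [deriv_const_mul_field, deriv_sin_mul]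
  ring

theorem iteratedDeriv_two_sin (a : ℝ) :
    iteratedDeriv 2 (fun x => Real.sin (a * x)) = fun x => -a ^ 2 * Real.sin (a * x) := by
  rw [iteratedDeriv_succ, iteratedDeriv_one, deriv_sin_mul]
  funext x
  rw [deriv_const_mul_field, deriv_cos_mul]
  ring

theorem iteratedDeriv_three_cos (a : ℝ) :
    iteratedDeriv 3 (fun x => Real.cos (a * x)) = fun x => a ^ 3 * Real.sin (a * x) := by
  rw [iteratedDeriv_succ, iteratedDeriv_two_cos]
  funext x
  rw [deriv_const_mul_field, deriv_cos_mul]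
  ring

theorem iteratedDeriv_three_sin (a : ℝ) :
    iteratedDeriv 3 (fun x => Real.sin (a * x)) = fun x => -a ^ 3 * Real.cos (a * x) := by
  rw [iteratedDeriv_succ, iteratedDeriv_two_sin]
  funext x
  rw [deriv_const_mul_field, deriv_sin_mul]
  ring

theorem integral_mul_const_mul {L : ℝ} (g χ : ℝ → ℝ) (a : ℝ) :
    ∫ x, g x * (a * χ x) ∂(perMeas L) = a * ∫ x, g x * χ x ∂(perMeas L) := by
  rw [← integral_const_mul]
  congr 1; funext x; ring

/-- The rate of change of the energy of the `k`-th mode at a state `g` with weak derivative `h`,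
when the forcing is represented by `(w₁, w₂)`. The dispersive term does not contribute. -/
noncomputable def modeEnergyRate {L : ℝ} (ν β : ℝ) (w₁ w₂ g h : L2per L) (k : ℤ) : ℝ :=
  2 * (-ν * modePairing L h h k + β * modePairing L g g k
    + 1 / 2 * modePairing L h (fun x => g x ^ 2) k + modePairing L g w₁ k + modePairing L h w₂ k)

/-- The weak formulation tested with the two functions of the `k`-th mode: the contributions of the
dispersive term to the cosine and sine coefficients are opposite, so that `γ` disappears. -/
theorem mode_rate_eq {L : ℝ} (hL : 0 < L) {f : VDual L} {w₁ w₂ : L2per L}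
    (hf : ∀ p : VSpace L, f p
      = (∫ x, (p : WithLp 2 (L2per L × L2per L)).fst x * w₁ x ∂(perMeas L))
        + ∫ x, (p : WithLp 2 (L2per L × L2per L)).snd x * w₂ x ∂(perMeas L))
    (ν β γ : ℝ) {g h : L2per L} (H : HasWeakDeriv g h) {k : ℤ} (hk : k ≠ 0) :
    2 * (cosCoeff L g k * weakRHS ν β γ f (isTest_cos hL.ne' k) (integral_cos_eq_zero hL hk) g)
      + 2 * (sinCoeff L g k * weakRHS ν β γ f (isTest_sin hL.ne' k) (integral_sin_eq_zero hL hk) g)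
      = modeEnergyRate ν β w₁ w₂ g h k := by
  simp only [weakRHS, apply_testV hf, iteratedDeriv_two_cos, iteratedDeriv_three_cos,
    iteratedDeriv_two_sin, iteratedDeriv_three_sin, deriv_cos_mul, deriv_sin_mul,
    integral_mul_const_mul, modeEnergyRate, modePairing]
  rw [H.cosCoeff_eq hL.ne', H.sinCoeff_eq hL.ne']
  simp only [cosCoeff, sinCoeff]
  ring

theorem abs_sum_modeEnergyRate_le {L : ℝ} (hL : 0 < L) {ν : ℝ} (hν : 0 ≤ ν) (β : ℝ)
    (w₁ w₂ : L2per L) {g h : L2per L} (hg : g ∈ HSpace L) (H : HasWeakDeriv g h) (s : Finset ℤ) :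
    |∑ k ∈ s, modeEnergyRate ν β w₁ w₂ g h k|
      ≤ 2 * L * (ν * (2 * ‖h‖ ^ 2) + |β| * (2 * ‖g‖ ^ 2)
        + (‖h‖ ^ 2 + L * ‖h‖ ^ 2 * ‖g‖ ^ 2) + (‖g‖ ^ 2 + ‖w₁‖ ^ 2) + (‖h‖ ^ 2 + ‖w₂‖ ^ 2)) := by
  have b1 := abs_sum_modePairing_le hL (Lp.memLp h) (Lp.memLp h) s
  have b2 := abs_sum_modePairing_le hL (Lp.memLp g) (Lp.memLp g) s
  have b3 := abs_sum_modePairing_le hL (Lp.memLp h) (H.memLp_sq hL hg) s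
  have b4 := abs_sum_modePairing_le hL (Lp.memLp g) (Lp.memLp w₁) s
  have b5 := abs_sum_modePairing_le hL (Lp.memLp h) (Lp.memLp w₂) s
  have b6 := mul_le_mul_of_nonneg_left (H.integral_pow_four_le hL hg) hL.le
  simp only [← norm_sq_L2per] at b1 b2 b3 b4 b5
  have e : ∑ k ∈ s, modeEnergyRate ν β w₁ w₂ g h k
      = 2 * (-ν * ∑ k ∈ s, modePairing L h h k + β * ∑ k ∈ s, modePairing L g g k
        + 1 / 2 * ∑ k ∈ s, modePairing L h (fun x => g x ^ 2) k + ∑ k ∈ s, modePairing L g w₁ k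
        + ∑ k ∈ s, modePairing L h w₂ k) := by
    simp only [modeEnergyRate, Finset.mul_sum, ← Finset.sum_add_distrib]
  rw [e, abs_mul, abs_of_pos (two_pos : (0 : ℝ) < 2)]
  have t1 : |(-ν) * ∑ k ∈ s, modePairing L h h k| ≤ ν * (L * (‖h‖ ^ 2 + ‖h‖ ^ 2)) := by
    rw [abs_mul, abs_neg, abs_of_nonneg hν]; gcongr
  have t2 : |β * ∑ k ∈ s, modePairing L g g k| ≤ |β| * (L * (‖g‖ ^ 2 + ‖g‖ ^ 2)) := by
    rw [abs_mul]; gcongr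
  have t3 : |(1 / 2) * ∑ k ∈ s, modePairing L h (fun x => g x ^ 2) k|
      ≤ L * (‖h‖ ^ 2 + L * ‖h‖ ^ 2 * ‖g‖ ^ 2) := by
    rw [abs_mul, abs_of_pos (by norm_num : (0 : ℝ) < 1 / 2)]
    nlinarith [abs_nonneg (∑ k ∈ s, modePairing L h (fun x => g x ^ 2) k)]
  have t := (abs_add_le _ _).trans (add_le_add ((abs_add_le _ _).trans (add_le_add
    ((abs_add_le _ _).trans (add_le_add ((abs_add_le _ _).trans (add_le_add t1 t2)) t3)) b4)) b5)
  linarith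

theorem hasSum_modeEnergyRate {L : ℝ} (hL : 0 < L) (ν β : ℝ) (w₁ w₂ : L2per L) {g h : L2per L}
    (hg : g ∈ HSpace L) (H : HasWeakDeriv g h) :
    HasSum (modeEnergyRate ν β w₁ w₂ g h)
      (L * (2 * (-ν * ‖h‖ ^ 2 + β * ‖g‖ ^ 2
        + ((∫ x, g x * w₁ x ∂(perMeas L)) + ∫ x, h x * w₂ x ∂(perMeas L))))) := by
  have s1 := hasSum_modePairing hL (Lp.memLp h) (Lp.memLp h)
  have s2 := hasSum_modePairing hL (Lp.memLp g) (Lp.memLp g)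
  have s3 := hasSum_modePairing hL (Lp.memLp h) (H.memLp_sq hL hg)
  have s4 := hasSum_modePairing hL (Lp.memLp g) (Lp.memLp w₁)
  have s5 := hasSum_modePairing hL (Lp.memLp h) (Lp.memLp w₂)
  have z : ∫ x, h x * g x ^ 2 ∂(perMeas L) = 0 := by
    rw [← H.integral_sq_mul_deriv hL]
    congr 1; funext x; ring
  simp only [← sq, ← norm_sq_L2per] at s1 s2
  rw [z] at s3
  have s := (((((s1.mul_left (-ν)).add (s2.mul_left β)).add (s3.mul_left (1 / 2))).add s4).add
    s5).mul_left 2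
  convert! s using 1
  ring

/-- The energy equality for a single Fourier mode, in time-integrated form. The integrability is
part of the statement because the modes are summed under the integral sign afterwards. -/
theorem IsSolution.mode_energy {L : ℝ} (hL : 0 < L) {ν β γ : ℝ} {f : VDual L} {u₀ : HSpace L}
    {u : ℝ → HSpace L} (hu : IsSolution ν β γ f u₀ u) {v : ℝ → VSpace L}
    (hv : ∀ᵐ t ∂(volume.restrict (Ici (0 : ℝ))),
      (v t : WithLp 2 (L2per L × L2per L)).fst = (u t : L2per L))
    {w₁ w₂ : L2per L} (hf : ∀ p : VSpace L, f p
      = (∫ x, (p : WithLp 2 (L2per L × L2per L)).fst x * w₁ x ∂(perMeas L))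
        + ∫ x, (p : WithLp 2 (L2per L × L2per L)).snd x * w₂ x ∂(perMeas L))
    {s t : ℝ} (hs : 0 ≤ s) (hst : s ≤ t) (k : ℤ) :
    IntervalIntegrable (fun τ => modeEnergyRate ν β w₁ w₂ (u τ)
        (v τ : WithLp 2 (L2per L × L2per L)).snd k) volume s t ∧
    (cosCoeff L (u t : L2per L) k ^ 2 + sinCoeff L (u t : L2per L) k ^ 2)
      - (cosCoeff L (u s : L2per L) k ^ 2 + sinCoeff L (u s : L2per L) k ^ 2)
      = ∫ τ in s..t, modeEnergyRate ν β w₁ w₂ (u τ)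
        (v τ : WithLp 2 (L2per L × L2per L)).snd k := by
  have hae : ∀ᵐ τ ∂(volume.restrict (uIoc s t)),
      HasWeakDeriv (u τ : L2per L) (v τ : WithLp 2 (L2per L × L2per L)).snd := by
    rw [uIoc_of_le hst]
    have hsub : Ioc s t ⊆ Ici 0 := fun x hx => hs.trans hx.1.le
    filter_upwards [ae_mono (Measure.restrict_mono hsub le_rfl) hv] with τ hτ
    rw [← hτ]
    exact (v τ).2.2
  rcases eq_or_ne k 0 with rfl | hk
  · have e : (fun τ => (0 : ℝ)) =ᵐ[volume.restrict (uIoc s t)]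
        fun τ => modeEnergyRate ν β w₁ w₂ (u τ) (v τ : WithLp 2 (L2per L × L2per L)).snd 0 := by
      filter_upwards [hae] with τ H
      simp only [modeEnergyRate, modePairing]
      rw [H.cosCoeff_eq hL.ne', sinCoeff_zero, sinCoeff_zero, cosCoeff_zero (u τ).2]
      ring
    refine ⟨(intervalIntegrable_const (c := (0 : ℝ))).congr_ae e, ?_⟩
    rw [← intervalIntegral.integral_congr_ae_restrict e, cosCoeff_zero (u t).2,
      cosCoeff_zero (u s).2, sinCoeff_zero, sinCoeff_zero]
    simp
  · have hc1 := hu.continuousOn_weakRHS (isTest_cos hL.ne' k) (integral_cos_eq_zero hL hk)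
    have hc2 := hu.continuousOn_weakRHS (isTest_sin hL.ne' k) (integral_sin_eq_zero hL hk)
    have ha : ContinuousOn (fun τ => cosCoeff L (u τ : L2per L) k) (Ici 0) :=
      (continuous_integral_mul (isTest_cos hL.ne' k).memLp).comp_continuousOn hu.continuousOn_coe
    have hb : ContinuousOn (fun τ => sinCoeff L (u τ : L2per L) k) (Ici 0) :=
      (continuous_integral_mul (isTest_sin hL.ne' k).memLp).comp_continuousOn hu.continuousOn_coe
    have i1 : IntervalIntegrable (fun τ => 2 * (cosCoeff L (u τ : L2per L) k *
        weakRHS ν β γ f (isTest_cos hL.ne' k) (integral_cos_eq_zero hL hk) (u τ))) volume s t :=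
      intervalIntegrable_of_continuousOn_Ici
        ((continuousOn_const (c := (2 : ℝ))).mul (ha.mul hc1)) hs (hs.trans hst)
    have i2 : IntervalIntegrable (fun τ => 2 * (sinCoeff L (u τ : L2per L) k *
        weakRHS ν β γ f (isTest_sin hL.ne' k) (integral_sin_eq_zero hL hk) (u τ))) volume s t :=
      intervalIntegrable_of_continuousOn_Ici
        ((continuousOn_const (c := (2 : ℝ))).mul (hb.mul hc2)) hs (hs.trans hst)
    have e1 := sq_sub_sq_eq_integral hc1 (F := fun τ => cosCoeff L (u τ : L2per L) k)
      (fun s t hs ht => hu.pairing_sub _ _ hs ht) hs hst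
    have e2 := sq_sub_sq_eq_integral hc2 (F := fun τ => sinCoeff L (u τ : L2per L) k)
      (fun s t hs ht => hu.pairing_sub _ _ hs ht) hs hst
    have e : ∀ᵐ τ ∂(volume.restrict (uIoc s t)), _ := hae.mono fun τ H =>
      mode_rate_eq hL hf ν β γ H hk
    refine ⟨(i1.add i2).congr_ae e, ?_⟩
    rw [← intervalIntegral.integral_congr_ae_restrict e, intervalIntegral.integral_add i1 i2,
      ← e1, ← e2]
    ring

theorem intervalIntegrable_norm_sq_snd {L : ℝ} {v : ℝ → VSpace L}
    (hvm : ∀ T : ℝ, 0 < T → MemLp v 2 (volume.restrict (Icc 0 T))) {s t : ℝ} (hs : 0 ≤ s)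
    (hst : s ≤ t) :
    IntervalIntegrable (fun τ => ‖(v τ : WithLp 2 (L2per L × L2per L)).snd‖ ^ 2) volume s t := by
  rw [intervalIntegrable_iff_integrableOn_Ioc_of_le hst]
  have hsub : Ioc s t ⊆ Icc 0 (t + 1) := fun x hx => ⟨hs.trans hx.1.le, by linarith [hx.2]⟩
  have h1 := hvm (t + 1) (by linarith)
  have h2 : MemLp (fun τ => (v τ : WithLp 2 (L2per L × L2per L)).snd) 2
      (volume.restrict (Icc 0 (t + 1))) :=
    ((WithLp.sndL 2 ℝ (L2per L) (L2per L)).comp (VSpace L).subtypeL).comp_memLp' h1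
  exact (h2.norm.integrable_sq.mono_measure
    (Measure.restrict_mono hsub le_rfl))

theorem intervalIntegrable_apply {L : ℝ} (f : VDual L) {v : ℝ → VSpace L}
    (hvm : ∀ T : ℝ, 0 < T → MemLp v 2 (volume.restrict (Icc 0 T))) {s t : ℝ} (hs : 0 ≤ s)
    (hst : s ≤ t) : IntervalIntegrable (fun τ => f (v τ)) volume s t := by
  rw [intervalIntegrable_iff_integrableOn_Ioc_of_le hst]
  have hsub : Ioc s t ⊆ Icc 0 (t + 1) := fun x hx => ⟨hs.trans hx.1.le, by linarith [hx.2]⟩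
  have h2 : MemLp (fun τ => f (v τ)) 2 (volume.restrict (Icc 0 (t + 1))) :=
    f.comp_memLp' (hvm (t + 1) (by linarith))
  exact ((h2.integrable (by norm_num)).mono_measure
    (Measure.restrict_mono hsub le_rfl))

/-- **The energy equality.** Although `u_t` need not belong to `L²(V')` on account of the dispersive
term, it holds for all weak solutions, since it holds for Fourier truncations with the dispersive
term cancelling in every mode. -/
theorem IsSolution.energy {L : ℝ} (hL : 0 < L) {ν β γ : ℝ} (hν : 0 ≤ ν) {f : VDual L}
    {u₀ : HSpace L} {u : ℝ → HSpace L} (hu : IsSolution ν β γ f u₀ u) {v : ℝ → VSpace L}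
    (hv : ∀ᵐ t ∂(volume.restrict (Ici (0 : ℝ))),
      (v t : WithLp 2 (L2per L × L2per L)).fst = (u t : L2per L))
    (hvm : ∀ T : ℝ, 0 < T → MemLp v 2 (volume.restrict (Icc 0 T)))
    {s t : ℝ} (hs : 0 ≤ s) (hst : s ≤ t) :
    ‖(u t : L2per L)‖ ^ 2 - ‖(u s : L2per L)‖ ^ 2
      = ∫ τ in s..t, 2 * (-ν * ‖(v τ : WithLp 2 (L2per L × L2per L)).snd‖ ^ 2
          + β * ‖(u τ : L2per L)‖ ^ 2 + f (v τ)) := by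
  obtain ⟨w₁, w₂, hf⟩ := exists_representation f
  have hsub : Ioc s t ⊆ Ici 0 := fun x hx => hs.trans hx.1.le
  have hvs : ∀ᵐ τ ∂(volume.restrict (Ioc s t)),
      (v τ : WithLp 2 (L2per L × L2per L)).fst = (u τ : L2per L) :=
    ae_mono (Measure.restrict_mono hsub le_rfl) hv
  have hae : ∀ᵐ τ ∂(volume.restrict (Ioc s t)),
      HasWeakDeriv (u τ : L2per L) (v τ : WithLp 2 (L2per L × L2per L)).snd := by
    filter_upwards [hvs] with τ hτ
    rw [← hτ]
    exact (v τ).2.2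
  obtain ⟨M, hM⟩ := (isCompact_Icc (a := s) (b := t)).exists_bound_of_continuousOn
    (hu.continuousOn_coe.mono fun x hx => hs.trans hx.1)
  have hM2 : ∀ τ ∈ Icc s t, ‖(u τ : L2per L)‖ ^ 2 ≤ M ^ 2 := fun τ hτ =>
    pow_le_pow_left₀ (norm_nonneg _) (hM τ hτ) 2
  have hmode := fun k => hu.mode_energy hL hv hf hs hst k
  -- the integrated energy balance of finitely many modes, and its two limits
  have hfin : ∀ S : Finset ℤ,
      ∫ τ in s..t, ∑ k ∈ S, modeEnergyRate ν β w₁ w₂ (u τ)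
          (v τ : WithLp 2 (L2per L × L2per L)).snd k
        = ∑ k ∈ S, ((cosCoeff L (u t : L2per L) k ^ 2 + sinCoeff L (u t : L2per L) k ^ 2)
      - (cosCoeff L (u s : L2per L) k ^ 2 + sinCoeff L (u s : L2per L) k ^ 2)) := by
    intro S
    rw [intervalIntegral.integral_finsetSum fun k _ => (hmode k).1]
    exact Finset.sum_congr rfl fun k _ => (hmode k).2.symm
  have lim1 : Tendsto (fun S : Finset ℤ => ∫ τ in s..t, ∑ k ∈ S, modeEnergyRate ν β w₁ w₂ (u τ)
      (v τ : WithLp 2 (L2per L × L2per L)).snd k) atTop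
      (𝓝 (L * ‖(u t : L2per L)‖ ^ 2 - L * ‖(u s : L2per L)‖ ^ 2)) := by
    simp only [hfin, norm_sq_L2per]
    exact (hasSum_sq_coeff hL (Lp.memLp _)).sub (hasSum_sq_coeff hL (Lp.memLp _))
  have lim2 : Tendsto (fun S : Finset ℤ => ∫ τ in s..t, ∑ k ∈ S, modeEnergyRate ν β w₁ w₂ (u τ)
      (v τ : WithLp 2 (L2per L × L2per L)).snd k) atTop
      (𝓝 (∫ τ in s..t, L * (2 * (-ν * ‖(v τ : WithLp 2 (L2per L × L2per L)).snd‖ ^ 2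
          + β * ‖(u τ : L2per L)‖ ^ 2 + f (v τ))))) := by
    have hint := intervalIntegrable_norm_sq_snd hvm hs hst
    refine intervalIntegral.tendsto_integral_filter_of_dominated_convergence
      (fun τ => 2 * L * (2 * ν + 1 + L * M ^ 2 + 1) * ‖(v τ : WithLp 2 (L2per L × L2per L)).snd‖ ^ 2
        + 2 * L * (|β| * (2 * M ^ 2) + M ^ 2 + ‖w₁‖ ^ 2 + ‖w₂‖ ^ 2))
      (Eventually.of_forall fun S => ?_) (Eventually.of_forall fun S => ?_)
      ((hint.const_mul _).add intervalIntegrable_const) ?_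
    · rw [uIoc_of_le hst]
      refine Finset.aestronglyMeasurable_fun_sum S fun k _ => ?_
      exact ((intervalIntegrable_iff_integrableOn_Ioc_of_le hst).1
        (hmode k).1).aestronglyMeasurable
    · rw [uIoc_of_le hst]
      filter_upwards [ae_imp_of_ae_restrict hae] with τ H hτ
      refine (abs_sum_modeEnergyRate_le hL hν β w₁ w₂ (u τ).2 (H hτ) S).trans ?_
      have hMτ := hM2 τ (Ioc_subset_Icc_self hτ)
      set A := ‖(v τ : WithLp 2 (L2per L × L2per L)).snd‖ ^ 2 with hA
      have hA0 : 0 ≤ A := by positivity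
      calc _ ≤ 2 * L * (ν * (2 * A) + |β| * (2 * M ^ 2) + (A + L * A * M ^ 2)
            + (M ^ 2 + ‖w₁‖ ^ 2) + (A + ‖w₂‖ ^ 2)) := by gcongr
        _ = _ := by ring
    · rw [uIoc_of_le hst]
      filter_upwards [ae_imp_of_ae_restrict hae, ae_imp_of_ae_restrict hvs] with τ H hvτ hτ
      have h1 := hasSum_modeEnergyRate hL ν β w₁ w₂ (u τ).2 (H hτ)
      have h2 := hf (v τ)
      rw [hvτ hτ] at h2
      rw [← h2] at h1
      exact h1
  have h := tendsto_nhds_unique lim1 lim2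
  rw [intervalIntegral.integral_const_mul, ← mul_sub] at h
  exact mul_left_cancel₀ hL.ne' h

/-! ### Gauge functions -/

theorem IsTest.integrable_perMeas {L : ℝ} {φ : ℝ → ℝ} (hφ : IsTest L φ) :
    Integrable φ (perMeas L) :=
  hφ.memLp.integrable (by norm_num)

theorem perMeas_real_univ {L : ℝ} (hL : 0 < L) : (perMeas L).real univ = L := by
  rw [measureReal_restrict_apply_univ, Real.volume_real_Ioc_of_le (by linarith)]
  ring

/-- Two points at which `|sin(πx/L)| ≤ σ` holds are at distance at most `Lσ` on the torus. -/
theorem torus_dist_le {L σ x y : ℝ} (hL : 0 < L) (hx : |Real.sin (Real.pi * x / L)| ≤ σ)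
    (hy : |Real.sin (Real.pi * y / L)| ≤ σ) (hxy : |x - y| ≤ L) :
    min |x - y| (L - |x - y|) ≤ L * σ := by
  have hpi := Real.pi_pos
  have h1 : |Real.sin (Real.pi * x / L - Real.pi * y / L)| ≤ 2 * σ := by
    rw [Real.sin_sub]
    refine (abs_sub _ _).trans ?_
    rw [abs_mul, abs_mul]
    have a1 := Real.abs_cos_le_one (Real.pi * x / L)
    have a2 := Real.abs_cos_le_one (Real.pi * y / L)
    have b1 := mul_le_mul hx a2 (abs_nonneg _) ((abs_nonneg _).trans hx)
    have b2 := mul_le_mul a1 hy (abs_nonneg _) zero_le_one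
    linarith
  have h2 : Real.sin (Real.pi * |x - y| / L) ≤ 2 * σ := by
    refine le_trans ?_ h1
    rcases abs_choice (x - y) with h | h
    · rw [h, show Real.pi * (x - y) / L = Real.pi * x / L - Real.pi * y / L by ring]
      exact le_abs_self _
    · rw [h, show Real.pi * -(x - y) / L = -(Real.pi * x / L - Real.pi * y / L) by ring,
        Real.sin_neg]
      exact neg_le_abs _
  have key : ∀ d, 0 ≤ d → d ≤ L / 2 → Real.sin (Real.pi * d / L) ≤ 2 * σ → d ≤ L * σ := by
    intro d hd hd2 h
    have h3 := Real.mul_le_sin (x := Real.pi * d / L) (by positivity) (by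
      rw [div_le_div_iff₀ hL two_pos]; nlinarith)
    have h4 : 2 / Real.pi * (Real.pi * d / L) = 2 * (d / L) := by field_simp
    have h5 : d / L ≤ σ := by linarith
    rwa [div_le_iff₀ hL, mul_comm] at h5
  rcases le_total |x - y| (L / 2) with h | h
  · exact (min_le_left _ _).trans (key _ (abs_nonneg _) h h2)
  · refine (min_le_right _ _).trans (key _ (by linarith) (by linarith) ?_)
    rwa [show Real.pi * (L - |x - y|) / L = Real.pi - Real.pi * |x - y| / L by field_simp,
      Real.sin_pi_sub]

/-- Smooth probability densities on the torus concentrated at scale `Lσ`, with the natural bounds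
on their `L²` norm and that of their derivative. -/
theorem exists_concentrated_density : ∃ K : ℝ, 0 < K ∧ ∀ L σ : ℝ, 0 < L → 0 < σ → σ ≤ 1 →
    ∃ δ : ℝ → ℝ, IsTest L δ ∧ (∀ x, 0 ≤ δ x) ∧ ∫ x, δ x ∂(perMeas L) = 1 ∧
      (∀ x y, |x - y| ≤ L → δ x ≠ 0 → δ y ≠ 0 → min |x - y| (L - |x - y|) ≤ L * σ) ∧
      ∫ x, δ x ^ 2 ∂(perMeas L) ≤ K / (L * σ) ∧
      ∫ x, deriv δ x ^ 2 ∂(perMeas L) ≤ K / (L * σ) ^ 3 := by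
  let G : ContDiffBump (0 : ℝ) := ⟨1 / 2, 1, by norm_num, by norm_num⟩
  have hGd : HasCompactSupport (deriv G) := G.hasCompactSupport.deriv
  obtain ⟨M, hM⟩ := (hGd.exists_bound_of_continuous
    ((G.contDiff (n := 1)).continuous_deriv (by simp)))
  -- the density is `G(sin(πx/L)/σ)`, which is periodic as `G` is even, divided by its integral
  have hGd0 : ∀ s, 1 < |s| → deriv G s = 0 := by
    intro s hs
    by_contra h
    have h1 := support_deriv_subset (f := G) (Function.mem_support.2 h)
    rw [G.tsupport_eq, mem_closedBall_zero_iff] at h1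
    exact absurd h1 (not_le.2 hs)
  have hpi := Real.pi_pos
  refine ⟨Real.pi + Real.pi ^ 4 * M ^ 2, by positivity, fun L σ hL hσ hσ1 => ?_⟩
  have hLσ : 0 < L * σ := mul_pos hL hσ
  set p : ℝ → ℝ := fun x => G (Real.sin (Real.pi * x / L) / σ) with hp
  have hptest : IsTest L p := by
    refine ⟨?_, fun x => ?_⟩
    · refine G.contDiff.comp (ContDiff.div_const (Real.contDiff_sin.comp ?_) _)
      exact (contDiff_const.mul contDiff_id).div_const _
    · simp only [hp]
      rw [show Real.pi * (x + L) / L = Real.pi * x / L + Real.pi by field_simp, Real.sin_add_pi,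
        neg_div, G.neg]
  have hp0 : ∀ x, 0 ≤ p x := fun x => G.nonneg
  have hp1 : ∀ x, p x ≤ 1 := fun x => G.le_one
  have hsupp : ∀ x, p x ≠ 0 → |Real.sin (Real.pi * x / L)| ≤ σ := by
    intro x hx
    have h1 : Real.sin (Real.pi * x / L) / σ ∈ Function.support G := hx
    rw [G.support_eq, mem_ball_zero_iff, Real.norm_eq_abs, abs_div, abs_of_pos hσ,
      div_lt_iff₀ hσ] at h1
    have : |Real.sin (Real.pi * x / L)| < 1 * σ := h1
    linarith
  set I := ∫ x, p x ∂(perMeas L) with hI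
  have hIlow : L * σ / Real.pi ≤ I := by
    have hsub : Ioc (-(L * σ / (2 * Real.pi))) (L * σ / (2 * Real.pi))
        ⊆ Ioc (-(L / 2)) (L / 2) := by
      have : L * σ / (2 * Real.pi) ≤ L / 2 := by
        rw [div_le_div_iff₀ (by positivity) two_pos]
        have := Real.two_le_pi
        nlinarith [mul_le_mul_of_nonneg_left hσ1 hL.le]
      exact Ioc_subset_Ioc (by linarith) this
    have hd0 : 0 ≤ L * σ / (2 * Real.pi) := by positivity
    have h1 : ∫ x in Ioc (-(L * σ / (2 * Real.pi))) (L * σ / (2 * Real.pi)), (1 : ℝ) ∂(perMeas L)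
        = L * σ / Real.pi := by
      rw [setIntegral_const, measureReal_restrict_apply measurableSet_Ioc,
        inter_eq_left.2 hsub, Real.volume_real_Ioc_of_le (by linarith), smul_eq_mul, mul_one]
      field_simp
      ring
    rw [← h1]
    refine le_trans (setIntegral_mono_on (integrable_const _).integrableOn
      hptest.integrable_perMeas.integrableOn measurableSet_Ioc fun x hx => ?_)
      (setIntegral_le_integral hptest.integrable_perMeas (ae_of_all _ hp0))
    refine (G.one_of_mem_closedBall ?_).ge
    rw [mem_closedBall_zero_iff, Real.norm_eq_abs, abs_div, abs_of_pos hσ, div_le_iff₀ hσ]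
    have h2 : |Real.sin (Real.pi * x / L)| ≤ |Real.pi * x / L| := Real.abs_sin_le_abs
    have h3 : |x| ≤ L * σ / (2 * Real.pi) := abs_le.2 ⟨hx.1.le, hx.2⟩
    have h4 : |Real.pi * x / L| ≤ 1 / 2 * σ := by
      rw [abs_div, abs_mul, abs_of_pos hpi, abs_of_pos hL, div_le_iff₀ hL]
      calc Real.pi * |x| ≤ Real.pi * (L * σ / (2 * Real.pi)) := by gcongr
        _ = 1 / 2 * σ * L := by field_simp
    exact h2.trans h4
  have hI0 : 0 < I := lt_of_lt_of_le (by positivity) hIlow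
  have hA : I⁻¹ ≤ Real.pi / (L * σ) := by
    rw [← inv_div]
    exact inv_anti₀ (by positivity) hIlow
  refine ⟨fun x => I⁻¹ * p x, ⟨contDiff_const.mul hptest.smooth, fun x => ?_⟩,
    fun x => mul_nonneg (inv_nonneg.2 hI0.le) (hp0 x), ?_, ?_, ?_, ?_⟩
  · simp only [hptest.periodic x]
  · rw [integral_const_mul, inv_mul_cancel₀ hI0.ne']
  · intro x y hxy hx hy
    exact torus_dist_le hL (hsupp x (right_ne_zero_of_mul hx)) (hsupp y (right_ne_zero_of_mul hy))
      hxy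
  · -- as `0 ≤ p ≤ 1`, the square of `p` has at most the integral of `p`
    have h1 : ∫ x, (I⁻¹ * p x) ^ 2 ∂(perMeas L) ≤ ∫ x, I⁻¹ ^ 2 * p x ∂(perMeas L) := by
      refine integral_mono_ae ((hptest.memLp.const_mul _).integrable_sq)
        (hptest.integrable_perMeas.const_mul _) (ae_of_all _ fun x => ?_)
      simp only [mul_pow]
      refine mul_le_mul_of_nonneg_left ?_ (sq_nonneg _)
      nlinarith [hp0 x, hp1 x]
    rw [integral_const_mul, ← hI, sq, mul_assoc, inv_mul_cancel₀ hI0.ne', mul_one] at h1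
    refine h1.trans (hA.trans ?_)
    gcongr
    have : 0 ≤ Real.pi ^ 4 * M ^ 2 := by positivity
    linarith
  · have hd : ∀ x, deriv (fun x => I⁻¹ * p x) x
        = I⁻¹ * (deriv G (Real.sin (Real.pi * x / L) / σ)
          * (Real.cos (Real.pi * x / L) * (Real.pi / L) / σ)) := by
      intro x
      have h1 : HasDerivAt (fun x : ℝ => Real.pi * x / L) (Real.pi / L) x := by
        simpa using ((hasDerivAt_id x).const_mul Real.pi).div_const L
      have h2 := (h1.sin).div_const σ
      have h3 : HasDerivAt G (deriv G (Real.sin (Real.pi * x / L) / σ))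
          (Real.sin (Real.pi * x / L) / σ) :=
        ((G.contDiff (n := 1)).differentiable (by simp) _).hasDerivAt
      exact ((h3.comp x h2).const_mul I⁻¹).deriv
    have hD : IsTest L (deriv fun x => I⁻¹ * p x) :=
      IsTest.deriv ⟨contDiff_const.mul hptest.smooth, fun x => by simp only [hptest.periodic x]⟩
    set B := Real.pi / (L * σ) * (M * (Real.pi / (L * σ))) with hB
    have hbd : ∀ᵐ x ∂(perMeas L), deriv (fun x => I⁻¹ * p x) x ^ 2
        ≤ (Icc (-(L * σ / 2)) (L * σ / 2)).indicator (fun _ => B ^ 2) x := by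
      filter_upwards [ae_restrict_mem measurableSet_Ioc] with x hx
      by_cases hxJ : x ∈ Icc (-(L * σ / 2)) (L * σ / 2)
      · rw [indicator_of_mem hxJ, hd x, ← sq_abs]
        refine pow_le_pow_left₀ (abs_nonneg _) ?_ 2
        rw [abs_mul, abs_mul, abs_of_pos (inv_pos.2 hI0)]
        have c1 : |Real.cos (Real.pi * x / L) * (Real.pi / L) / σ| ≤ Real.pi / (L * σ) := by
          rw [abs_div, abs_mul, abs_of_pos hσ, abs_of_pos (div_pos hpi hL), ← div_div]
          gcongr
          exact mul_le_of_le_one_left (by positivity) (Real.abs_cos_le_one _)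
        have c2 := hM (Real.sin (Real.pi * x / L) / σ)
        rw [Real.norm_eq_abs] at c2
        exact mul_le_mul hA (mul_le_mul c2 c1 (abs_nonneg _) ((abs_nonneg _).trans c2))
          (by positivity) (by positivity)
      · -- outside the interval, `|sin(πx/L)| > σ` by concavity of the sine
        rw [indicator_of_notMem hxJ, hd x, hGd0, zero_mul, mul_zero]
        · simp
        · rw [abs_div, abs_of_pos hσ, one_lt_div hσ]
          have hx' : L * σ / 2 < |x| := by
            by_contra hcon
            exact hxJ (abs_le.1 (not_lt.1 hcon))
          by_contra hcon
          have hxL : |x| ≤ L / 2 := abs_le.2 ⟨hx.1.le, hx.2⟩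
          have h3 := Real.mul_le_sin (x := Real.pi * |x| / L) (by positivity) (by
            rw [div_le_div_iff₀ hL two_pos]; nlinarith)
          have h4 : 2 / Real.pi * (Real.pi * |x| / L) = 2 * (|x| / L) := by field_simp
          have h5 : Real.sin (Real.pi * |x| / L) ≤ |Real.sin (Real.pi * x / L)| := by
            rcases abs_choice x with h | h
            · rw [h]; exact le_abs_self _
            · rw [h, show Real.pi * -x / L = -(Real.pi * x / L) by ring, Real.sin_neg]
              exact neg_le_abs _
          have h6 : |x| / L ≤ σ / 2 := by linarith [not_lt.1 hcon]
          rw [div_le_iff₀ hL] at h6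
          linarith
    have hmeas : (perMeas L).real (Icc (-(L * σ / 2)) (L * σ / 2)) ≤ L * σ := by
      rw [measureReal_restrict_apply measurableSet_Icc]
      refine (measureReal_mono inter_subset_left (by simp)).trans ?_
      rw [Real.volume_real_Icc_of_le (by linarith)]
      linarith
    have h1 := integral_mono_ae hD.memLp.integrable_sq
      ((integrable_const (B ^ 2)).indicator measurableSet_Icc) hbd
    rw [integral_indicator measurableSet_Icc, setIntegral_const, smul_eq_mul] at h1
    refine h1.trans ((mul_le_mul_of_nonneg_right hmeas (sq_nonneg _)).trans ?_)
    have h2 : L * σ * B ^ 2 = Real.pi ^ 4 * M ^ 2 / (L * σ) ^ 3 := by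
      rw [hB]; field_simp
    rw [h2]
    gcongr
    linarith

/-- A gauge function: a smooth mean-zero `φ` on the torus whose slope is `4β` except near one point,
at which a steep descent, given by the concentrated density `δ`, restores periodicity.
The parameter `σ` is the width of the descent relative to the period, and `K` the constant
in the bounds for the norms. -/
structure IsGauge (L β σ K : ℝ) (φ δ : ℝ → ℝ) : Prop where
  test : IsTest L φ
  mean : ∫ x, φ x ∂(perMeas L) = 0
  density_test : IsTest L δ
  density_nonneg : ∀ x, 0 ≤ δ x
  density_mass : ∫ x, δ x ∂(perMeas L) = 1
  concentrated : ∀ x y, |x - y| ≤ L → δ x ≠ 0 → δ y ≠ 0 → min |x - y| (L - |x - y|) ≤ L * σ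
  deriv_eq : ∀ x, deriv φ x = 4 * β * (1 - L * δ x)
  sq_le : ∫ x, φ x ^ 2 ∂(perMeas L) ≤ K * (β ^ 2 * L ^ 3)
  deriv_sq_le : ∫ x, deriv φ x ^ 2 ∂(perMeas L) ≤ K * (β ^ 2 * L / σ)
  deriv_two_sq_le : ∫ x, iteratedDeriv 2 φ x ^ 2 ∂(perMeas L) ≤ K * (β ^ 2 / (L * σ ^ 3))

theorem integral_perMeas_comp_add {L : ℝ} (hL : 0 < L) {F : ℝ → ℝ} (hF : Function.Periodic F L)
    (b : ℝ) : ∫ x, F (x + b) ∂(perMeas L) = ∫ x, F x ∂(perMeas L) := by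
  rw [integral_of_perMeas hL, integral_of_perMeas hL, intervalIntegral.integral_comp_add_right]
  have := hF.intervalIntegral_add_eq (-(L / 2) + b) (-(L / 2))
  rw [show L / 2 + b = -(L / 2) + b + L by ring, this]
  congr 1
  ring

theorem IsTest.translate {L : ℝ} {φ : ℝ → ℝ} (hφ : IsTest L φ) (b : ℝ) :
    IsTest L fun x => φ (x + b) where
  smooth := hφ.smooth.comp (contDiff_id.add contDiff_const)
  periodic := fun x => by
    have := hφ.periodic (x + b)
    rwa [add_right_comm] at this

theorem periodic_sq {L : ℝ} {F : ℝ → ℝ} (hF : Function.Periodic F L) :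
    Function.Periodic (fun x => F x ^ 2) L := fun x => by simp only [hF x]

theorem IsGauge.translate {L β σ K : ℝ} (hL : 0 < L) {φ δ : ℝ → ℝ} (h : IsGauge L β σ K φ δ)
    (b : ℝ) : IsGauge L β σ K (fun x => φ (x + b)) (fun x => δ (x + b)) where
  test := h.test.translate b
  mean := (integral_perMeas_comp_add hL h.test.periodic b).trans h.mean
  density_test := h.density_test.translate b
  density_nonneg := fun x => h.density_nonneg _
  density_mass := (integral_perMeas_comp_add hL h.density_test.periodic b).trans h.density_mass
  concentrated := fun x y hxy hx hy => by
    have := h.concentrated (x + b) (y + b) (by rwa [add_sub_add_right_eq_sub]) hx hy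
    rwa [add_sub_add_right_eq_sub] at this
  deriv_eq := fun x => by rw [deriv_comp_add_const]; exact h.deriv_eq _
  sq_le := (integral_perMeas_comp_add hL (periodic_sq h.test.periodic) b).trans_le h.sq_le
  deriv_sq_le := by
    simp only [deriv_comp_add_const]
    exact (integral_perMeas_comp_add hL (periodic_sq h.test.deriv.periodic) b).trans_le
      h.deriv_sq_le
  deriv_two_sq_le := by
    have e : ∀ x, iteratedDeriv 2 (fun x => φ (x + b)) x = iteratedDeriv 2 φ (x + b) := fun x => by
      rw [iteratedDeriv_comp_add_const]
    simp only [e]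
    exact (integral_perMeas_comp_add hL
      (periodic_sq (h.test.iteratedDeriv 2).periodic) b).trans_le h.deriv_two_sq_le

/-- Gauge functions exist, with an absolute constant in the bounds: integrate `4β(1 - Lδ)`. -/
theorem exists_gauge : ∃ K : ℝ, 0 < K ∧ ∀ L β σ : ℝ, 0 < L → 0 < β → 0 < σ → σ ≤ 1 →
    ∃ φ δ : ℝ → ℝ, IsGauge L β σ K φ δ := by
  obtain ⟨K, hK, hδ⟩ := exists_concentrated_density
  refine ⟨64 + 16 * K, by positivity, fun L β σ hL hβ hσ hσ1 => ?_⟩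
  obtain ⟨δ, htest, hnn, hmass, hconc, hsq, hdsq⟩ := hδ L σ hL hσ hσ1
  have hle : -(L / 2) ≤ L / 2 := by linarith
  set q : ℝ → ℝ := fun x => 4 * β * (1 - L * δ x) with hq
  have hqtest : IsTest L q := ⟨contDiff_const.mul (contDiff_const.sub
    (contDiff_const.mul htest.smooth)), fun x => by simp only [hq, htest.periodic x]⟩
  have hqint : ∫ x, q x ∂(perMeas L) = 0 := by
    simp only [hq]
    rw [integral_const_mul,
      integral_sub (integrable_const _) (htest.integrable_perMeas.const_mul L), integral_const_mul,
      hmass, integral_const, perMeas_real_univ hL]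
    simp
  set F : ℝ → ℝ := fun x => ∫ y in (0 : ℝ)..x, q y with hF
  have hFd : ∀ x, HasDerivAt F (q x) x := fun x =>
    hqtest.smooth.continuous.integral_hasStrictDerivAt 0 x |>.hasDerivAt
  have hFsub : ∀ x y, F y - F x = ∫ z in x..y, q z := fun x y =>
    intervalIntegral.integral_interval_sub_left (hqtest.smooth.continuous.intervalIntegrable _ _)
      (hqtest.smooth.continuous.intervalIntegrable _ _)
  set c := (1 / L) * ∫ x, F x ∂(perMeas L) with hc
  set φ : ℝ → ℝ := fun x => F x - c with hφ
  have hφd : ∀ x, HasDerivAt φ (q x) x := fun x => (hFd x).sub_const c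
  have hφ' : deriv φ = q := funext fun x => (hφd x).deriv
  have hφtest : IsTest L φ := by
    refine ⟨contDiff_infty_iff_deriv.2 ⟨fun x => (hφd x).differentiableAt, ?_⟩, fun x => ?_⟩
    · rw [hφ']; exact hqtest.smooth
    · have h1 := hFsub x (x + L)
      rw [hqtest.periodic.intervalIntegral_add_eq x (-(L / 2)),
        show -(L / 2) + L = L / 2 by ring, ← integral_of_perMeas hL, hqint] at h1
      simp only [hφ]
      linarith
  have hFi : Integrable F (perMeas L) := by
    have : F = fun x => φ x + c := by funext x; simp [hφ]
    rw [this]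
    exact hφtest.integrable_perMeas.add (integrable_const c)
  have hmean : ∫ x, φ x ∂(perMeas L) = 0 := by
    simp only [hφ]
    rw [integral_sub hFi (integrable_const _), integral_const, perMeas_real_univ hL, hc,
      smul_eq_mul]
    field_simp
    ring
  have hosc : ∀ x ∈ Ioc (-(L / 2)) (L / 2), ∀ y ∈ Ioc (-(L / 2)) (L / 2),
      |φ x - φ y| ≤ 8 * β * L := by
    intro x hx y hy
    have e : φ x - φ y = ∫ z in y..x, q z := by rw [← hFsub]; simp [hφ]
    have hb : ∀ z, ‖q z‖ ≤ 4 * β * (1 + L * δ z) := by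
      intro z
      rw [hq, Real.norm_eq_abs, abs_mul, abs_of_pos (by positivity : 0 < 4 * β)]
      refine mul_le_mul_of_nonneg_left ?_ (by positivity)
      have := mul_nonneg hL.le (hnn z)
      exact abs_le.2 ⟨by linarith, by linarith⟩
    have hint : Integrable (fun z => 4 * β * (1 + L * δ z)) (perMeas L) :=
      ((integrable_const _).add (htest.integrable_perMeas.const_mul L)).const_mul _
    have hval : ∫ z, 4 * β * (1 + L * δ z) ∂(perMeas L) = 8 * β * L := by
      rw [integral_const_mul, integral_add (integrable_const _)
        (htest.integrable_perMeas.const_mul L), integral_const_mul, hmass, integral_const,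
        perMeas_real_univ hL, smul_eq_mul]
      ring
    rw [e, ← hval]
    refine (intervalIntegral.norm_integral_le_integral_norm_uIoc (f := q)).trans ?_
    have hsub : uIoc y x ⊆ Ioc (-(L / 2)) (L / 2) := fun z hz =>
      ⟨(lt_min hy.1 hx.1).trans hz.1, hz.2.trans (max_le hy.2 hx.2)⟩
    have h1 : ∫ z in uIoc y x, ‖q z‖ ≤ ∫ z in uIoc y x, 4 * β * (1 + L * δ z) :=
      setIntegral_mono_on (hqtest.integrable_perMeas.norm.mono_measure
        (Measure.restrict_mono hsub le_rfl))
        (hint.mono_measure (Measure.restrict_mono hsub le_rfl)) measurableSet_uIoc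
        fun z _ => hb z
    refine h1.trans (setIntegral_mono_set hint (ae_of_all _ fun z => (norm_nonneg _).trans (hb z))
      (LE.le.eventuallyLE hsub))
  have hbound : ∀ x ∈ Ioc (-(L / 2)) (L / 2), |φ x| ≤ 8 * β * L := by
    intro x hx
    have e : L * φ x = ∫ y, (φ x - φ y) ∂(perMeas L) := by
      rw [integral_sub (integrable_const _) hφtest.integrable_perMeas, hmean, integral_const,
        perMeas_real_univ hL, smul_eq_mul, sub_zero]
    have h1 : ‖∫ y, (φ x - φ y) ∂(perMeas L)‖ ≤ 8 * β * L * (perMeas L).real univ :=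
      norm_integral_le_of_norm_le_const (by
        filter_upwards [ae_restrict_mem measurableSet_Ioc] with y hy using hosc x hx y hy)
    rw [← e, perMeas_real_univ hL, Real.norm_eq_abs, abs_mul, abs_of_pos hL, mul_comm] at h1
    exact le_of_mul_le_mul_right h1 hL
  refine ⟨φ, δ, hφtest, hmean, htest, hnn, hmass, hconc, fun x => by rw [hφ'], ?_, ?_, ?_⟩
  · have h1 : ∫ x, φ x ^ 2 ∂(perMeas L) ≤ ∫ _, (8 * β * L) ^ 2 ∂(perMeas L) := by
      refine integral_mono_ae hφtest.memLp.integrable_sq (integrable_const _) ?_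
      filter_upwards [ae_restrict_mem measurableSet_Ioc] with x hx
      rw [← sq_abs]
      exact pow_le_pow_left₀ (abs_nonneg _) (hbound x hx) 2
    rw [integral_const, perMeas_real_univ hL, smul_eq_mul] at h1
    have : 0 ≤ K * (β ^ 2 * L ^ 3) := by positivity
    linarith
  · have h1 : ∫ x, deriv φ x ^ 2 ∂(perMeas L)
        = 16 * β ^ 2 * (L ^ 2 * ∫ x, δ x ^ 2 ∂(perMeas L)) - 16 * β ^ 2 * L := by
      have i1 : Integrable (fun x => L ^ 2 * δ x ^ 2) (perMeas L) :=
        htest.memLp.integrable_sq.const_mul _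
      have i2 : Integrable (fun x => 2 * L * δ x) (perMeas L) :=
        htest.integrable_perMeas.const_mul _
      have i3 : Integrable (fun x => L ^ 2 * δ x ^ 2 - 2 * L * δ x) (perMeas L) := i1.sub i2
      have e : ∀ x, deriv φ x ^ 2 = 16 * β ^ 2 * (L ^ 2 * δ x ^ 2 - 2 * L * δ x + 1) := fun x => by
        rw [hφ', hq]; ring
      simp only [e]
      rw [integral_const_mul, integral_add i3 (integrable_const _), integral_sub i1 i2,
        integral_const_mul, integral_const_mul, hmass, integral_const, perMeas_real_univ hL,
        smul_eq_mul]
      ring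
    rw [h1]
    have h2 : 16 * β ^ 2 * (L ^ 2 * ∫ x, δ x ^ 2 ∂(perMeas L))
        ≤ 16 * β ^ 2 * (L ^ 2 * (K / (L * σ))) := by gcongr
    have h3 : 16 * β ^ 2 * (L ^ 2 * (K / (L * σ))) = 16 * K * (β ^ 2 * L / σ) := by field_simp
    have h4 : 0 ≤ β ^ 2 * L / σ := by positivity
    have h5 : 0 ≤ 16 * β ^ 2 * L := by positivity
    linarith
  · have e : ∀ x, iteratedDeriv 2 φ x ^ 2 = 16 * β ^ 2 * L ^ 2 * deriv δ x ^ 2 := fun x => by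
      have hd : HasDerivAt q (4 * β * (-(L * deriv δ x))) x :=
        ((((htest.smooth.differentiable (by simp) x).hasDerivAt.const_mul L).const_sub 1).const_mul
          (4 * β))
      rw [iteratedDeriv_succ, iteratedDeriv_one, hφ', hd.deriv]
      ring
    simp only [e]
    rw [integral_const_mul]
    have h2 : 16 * β ^ 2 * L ^ 2 * ∫ x, deriv δ x ^ 2 ∂(perMeas L)
        ≤ 16 * β ^ 2 * L ^ 2 * (K / (L * σ) ^ 3) := by gcongr
    have h3 : 16 * β ^ 2 * L ^ 2 * (K / (L * σ) ^ 3) = 16 * K * (β ^ 2 / (L * σ ^ 3)) := by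
      field_simp
    have h4 : 0 ≤ β ^ 2 / (L * σ ^ 3) := by positivity
    linarith

/-! ### Differential inequalities and decay -/

theorem dualNorm_nonneg {L : ℝ} (f : VDual L) : 0 ≤ dualNorm f :=
  Real.sInf_nonneg fun _ hC => hC.1

/-- The infimum defining `|A^(-1/2) f|` is attained. -/
theorem abs_apply_le_dualNorm {L : ℝ} (hL : 0 < L) (f : VDual L) (p : VSpace L) :
    |f p| ≤ dualNorm f * ‖(p : WithLp 2 (L2per L × L2per L)).snd‖ := by
  -- Wirtinger's inequality makes `‖p.snd‖` an equivalent norm, so the set of bounds is nonempty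
  have hmem : ∃ C : ℝ, 0 ≤ C ∧
      ∀ φ : VSpace L, |f φ| ≤ C * ‖(φ : WithLp 2 (L2per L × L2per L)).snd‖ := by
    have hpos : 0 < 2 * Real.pi / L := by have := Real.pi_pos; positivity
    refine ⟨‖f‖ * √(1 / (2 * Real.pi / L) ^ 2 + 1), by positivity, fun q => ?_⟩
    have h1 := f.le_opNorm q
    rw [Real.norm_eq_abs] at h1
    refine h1.trans ?_
    rw [mul_assoc]
    refine mul_le_mul_of_nonneg_left ?_ (norm_nonneg f)
    refine le_of_sq_le_sq ?_ (by positivity)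
    have h2 : ‖q‖ ^ 2 = ‖(q : WithLp 2 (L2per L × L2per L)).fst‖ ^ 2
        + ‖(q : WithLp 2 (L2per L × L2per L)).snd‖ ^ 2 :=
      WithLp.prod_norm_sq_eq_of_L2 (q : WithLp 2 (L2per L × L2per L))
    have h3 := wirtinger hL q.2.1 q.2.2
    rw [h2, mul_pow, Real.sq_sqrt (by positivity), add_mul, one_mul, one_div_mul_eq_div]
    gcongr
    rwa [le_div_iff₀ (by positivity), mul_comm]
  obtain ⟨C, hC⟩ := hmem
  rcases (norm_nonneg (p : WithLp 2 (L2per L × L2per L)).snd).eq_or_lt with h0 | h0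
  · have := hC.2 p
    rw [← h0, mul_zero] at this ⊢
    exact this
  · rw [← div_le_iff₀ h0]
    exact le_csInf ⟨C, hC⟩ fun C' hC' => (div_le_iff₀ h0).2 (hC'.2 p)

/-- Gronwall's inequality for a continuous function whose increments to the right of every point
are bounded by the integral of a function controlled at that point only. -/
theorem le_of_integral_ineq {y : ℝ → ℝ} {μ K : ℝ} (hμ : 0 < μ) (hK : 0 ≤ K)
    (hy : ContinuousOn y (Ici 0))
    (h : ∀ x, 0 ≤ x → ∃ F : ℝ → ℝ, ContinuousOn F (Ici 0) ∧ F x ≤ -μ * y x + K ∧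
      ∀ z, x ≤ z → y z - y x ≤ ∫ τ in x..z, F τ) {t : ℝ} (ht : 0 ≤ t) :
    y t ≤ Real.exp (-μ * t) * y 0 + K / μ := by
  have key := le_gronwallBound_of_liminf_deriv_right_le (f := y) (f' := fun x => -μ * y x + K)
    (δ := y 0) (K := -μ) (ε := K) (a := 0) (b := t) (hy.mono fun x hx => hx.1) ?_ le_rfl
    (fun x _ => le_rfl) t ⟨ht, le_rfl⟩
  · rw [gronwallBound_of_K_ne_0 (by linarith)] at key
    simp only [sub_zero] at key
    have e : K / -μ * (Real.exp (-μ * t) - 1) = K / μ - K / μ * Real.exp (-μ * t) := by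
      rw [div_neg]; ring
    have : 0 ≤ K / μ * Real.exp (-μ * t) := by positivity
    rw [e] at key
    linarith
  · intro x hx r hr
    obtain ⟨F, hF, hFx, hint⟩ := h x hx.1
    have hFc : ContinuousWithinAt F (Ioi x) x :=
      (hF x hx.1).mono fun z hz => hx.1.trans (le_of_lt hz)
    have hd : HasDerivWithinAt (fun z => ∫ τ in x..z, F τ) (F x) (Ioi x) x := by
      refine HasDerivWithinAt.mono (t := Ici x) ?_ Ioi_subset_Ici_self
      refine intervalIntegral.integral_hasDerivWithinAt_right
        (intervalIntegrable_of_continuousOn_Ici hF hx.1 hx.1) (t := Ioi x) ?_ hFc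
      exact ContinuousOn.stronglyMeasurableAtFilter_nhdsWithin
        (hF.mono fun z hz => hx.1.trans (le_of_lt hz)) measurableSet_Ioi x
    have hev := hd.limsup_slope_le' (self_notMem_Ioi) (hFx.trans_lt hr)
    refine (hev.and self_mem_nhdsWithin).frequently.mono fun z hz => ?_
    have hzx : 0 < z - x := sub_pos.2 hz.2
    refine lt_of_le_of_lt ?_ hz.1
    rw [slope_def_field, intervalIntegral.integral_same, sub_zero, div_eq_inv_mul]
    exact mul_le_mul_of_nonneg_left (hint z (le_of_lt hz.2)) (inv_nonneg.2 hzx.le)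

theorem AbsorbingBall.mono {L ν β γ : ℝ} {f : VDual L} {ρ ρ' : ℝ} (h : AbsorbingBall ν β γ f ρ)
    (hρ : ρ ≤ ρ') : AbsorbingBall ν β γ f ρ' := fun R => by
  obtain ⟨t₁, h0, h1⟩ := h R
  exact ⟨t₁, h0, fun u₀ u hR hu t ht => (h1 u₀ u hR hu t ht).trans hρ⟩

/-- Exponential decay of the energy, up to a constant `K`, makes balls of squared radius larger
than `K` absorbing. -/
theorem absorbingBall_of_decay {L ν β γ : ℝ} {f : VDual L} {ρ μ K : ℝ} (hρ : 0 ≤ ρ) (hμ : 0 < μ)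
    (hK : K < ρ ^ 2) (h : ∀ R : ℝ, ∃ B : ℝ, ∀ (u₀ : HSpace L) (u : ℝ → HSpace L), ‖u₀‖ ≤ R →
      IsSolution ν β γ f u₀ u → ∀ t : ℝ, 0 ≤ t → ‖u t‖ ^ 2 ≤ Real.exp (-μ * t) * B + K) :
    AbsorbingBall ν β γ f ρ := by
  intro R
  obtain ⟨B, hB⟩ := h R
  have hlim : Tendsto (fun t : ℝ => Real.exp (-μ * t) * B + K) atTop (𝓝 (0 * B + K)) := by
    refine ((Real.tendsto_exp_atBot.comp ?_).mul_const B).add_const K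
    exact tendsto_id.const_mul_atTop_of_neg (neg_neg_of_pos hμ)
  rw [zero_mul, zero_add] at hlim
  obtain ⟨t₁, ht₁⟩ := eventually_atTop.1 (hlim.eventually_lt_const hK)
  refine ⟨max t₁ 0, le_max_right _ _, fun u₀ u hR hu t ht => ?_⟩
  have h1 := hB u₀ u hR hu t ((le_max_right _ _).trans ht)
  have h2 := ht₁ t ((le_max_left _ _).trans ht)
  exact le_of_sq_le_sq (h1.trans h2.le) hρ

theorem ae_fst_eq {L : ℝ} {u : ℝ → HSpace L} {v : ℝ → VSpace L}
    (hv : ∀ᵐ t ∂(volume.restrict (Ici (0 : ℝ))),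
      (v t : WithLp 2 (L2per L × L2per L)).fst = (u t : L2per L)) {s t : ℝ} (hs : 0 ≤ s) :
    ∀ᵐ τ ∂(volume.restrict (Icc s t)),
      (v τ : WithLp 2 (L2per L × L2per L)).fst = (u τ : L2per L) :=
  ae_mono (Measure.restrict_mono (fun _ hx => hs.trans hx.1) le_rfl) hv

theorem IsSolution.intervalIntegrable_energy {L : ℝ} {ν β γ : ℝ} {f : VDual L}
    {u₀ : HSpace L} {u : ℝ → HSpace L} (hu : IsSolution ν β γ f u₀ u) {v : ℝ → VSpace L}
    (hvm : ∀ T : ℝ, 0 < T → MemLp v 2 (volume.restrict (Icc 0 T)))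
    {s t : ℝ} (hs : 0 ≤ s) (hst : s ≤ t) :
    IntervalIntegrable (fun τ => 2 * (-ν * ‖(v τ : WithLp 2 (L2per L × L2per L)).snd‖ ^ 2
          + β * ‖(u τ : L2per L)‖ ^ 2 + f (v τ))) volume s t :=
  ((((intervalIntegrable_norm_sq_snd hvm hs hst).const_mul _).add
    ((intervalIntegrable_of_continuousOn_Ici (hu.continuousOn_coe.norm.pow 2) hs
      (hs.trans hst)).const_mul _)).add (intervalIntegrable_apply f hvm hs hst)).const_mul _

/-- When the linear operator is stable, the energy decays by itself. -/
theorem absorbingBall_of_stable {L ν β γ : ℝ} (hL : 0 < L) (hν : 0 < ν) (f : VDual L)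
    (hμ : 0 < ν * (2 * Real.pi / L) ^ 2 - 2 * β) {ρ : ℝ} (hρ : 0 ≤ ρ)
    (hlt : dualNorm f ^ 2 / (ν * (ν * (2 * Real.pi / L) ^ 2 - 2 * β)) < ρ ^ 2) :
    AbsorbingBall ν β γ f ρ := by
  set μ := ν * (2 * Real.pi / L) ^ 2 - 2 * β with hμdef
  set N := dualNorm f with hN
  refine absorbingBall_of_decay hρ hμ hlt fun R => ⟨R ^ 2, fun u₀ u hR hu t ht => ?_⟩
  obtain ⟨v, hv, hvm⟩ := hu.memL2V
  have hyc : ContinuousOn (fun τ => ‖(u τ : L2per L)‖ ^ 2) (Ici 0) := hu.continuousOn_coe.norm.pow 2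
  have h1 := le_of_integral_ineq (y := fun τ => ‖(u τ : L2per L)‖ ^ 2) (K := N ^ 2 / ν) hμ
    (by positivity) hyc (fun x hx => ?_) ht
  · rw [div_div] at h1
    refine h1.trans ?_
    gcongr
    rw [hu.init]
    exact hR
  · refine ⟨fun τ => -μ * ‖(u τ : L2per L)‖ ^ 2 + N ^ 2 / ν,
      (continuousOn_const.mul hyc).add continuousOn_const, le_rfl, fun z hz => ?_⟩
    dsimp only
    rw [hu.energy hL hν.le hv hvm hx hz]
    refine intervalIntegral.integral_mono_ae_restrict hz (hu.intervalIntegrable_energy hvm hx hz)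
      (intervalIntegrable_of_continuousOn_Ici
        ((continuousOn_const.mul hyc).add continuousOn_const) hx (hx.trans hz)) ?_
    filter_upwards [ae_fst_eq hv hx] with τ hτ
    have w := wirtinger hL (v τ).2.1 (v τ).2.2
    rw [hτ] at w
    have b := (le_abs_self _).trans (abs_apply_le_dualNorm hL f (v τ))
    set X := ‖(v τ : WithLp 2 (L2per L × L2per L)).snd‖
    have young : 2 * (N * X) ≤ N ^ 2 / ν + ν * X ^ 2 := by
      have h2 : 0 ≤ (N - ν * X) ^ 2 / ν := by positivity
      have h3 : (N - ν * X) ^ 2 / ν = N ^ 2 / ν - 2 * (N * X) + ν * X ^ 2 := by field_simp; ring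
      linarith
    have w2 := mul_le_mul_of_nonneg_left w hν.le
    rw [hμdef]
    nlinarith

theorem abs_integral_mul_le {L : ℝ} (h : L2per L) {χ : ℝ → ℝ} (hχ : MemLp χ 2 (perMeas L)) :
    |∫ x, h x * χ x ∂(perMeas L)| ≤ ‖h‖ * √(∫ x, χ x ^ 2 ∂(perMeas L)) := by
  have h1 := sq_integral_mul_le (Lp.memLp h) hχ
  rw [← norm_sq_L2per] at h1
  refine abs_le_of_sq_le_sq ?_ (by positivity)
  rwa [mul_pow, Real.sq_sqrt (integral_nonneg fun x => sq_nonneg _)]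

theorem norm_toLp_sq {L : ℝ} {χ : ℝ → ℝ} (hχ : MemLp χ 2 (perMeas L)) :
    ‖hχ.toLp χ‖ ^ 2 = ∫ x, χ x ^ 2 ∂(perMeas L) := by
  rw [norm_sq_L2per]
  refine integral_congr_ae ?_
  filter_upwards [hχ.coeFn_toLp] with x hx
  rw [hx]

theorem norm_sub_toLp_sq {L : ℝ} (g : L2per L) {χ : ℝ → ℝ} (hχ : MemLp χ 2 (perMeas L)) :
    ‖g - hχ.toLp χ‖ ^ 2 = ‖g‖ ^ 2 - 2 * (∫ x, g x * χ x ∂(perMeas L))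
      + ∫ x, χ x ^ 2 ∂(perMeas L) := by
  rw [norm_sub_sq_real, norm_toLp_sq, inner_L2per]
  congr 3
  refine integral_congr_ae ?_
  filter_upwards [hχ.coeFn_toLp] with x hx
  rw [hx]

/-- The differential inequality for the squared distance to a gauge function, at a fixed time:
`p` is the state of the solution, and the left-hand side the time derivative. -/
theorem IsGauge.rate_le {L ν β γ σ K : ℝ} (hL : 0 < L) (hν : 0 < ν) (hβ : 0 < β)
    (hσ : 8 * β * L ^ 2 * σ = ν) (f : VDual L) {φ δ : ℝ → ℝ} (hg : IsGauge L β σ K φ δ)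
    (p : VSpace L) {g : L2per L} (hpg : (p : WithLp 2 (L2per L × L2per L)).fst = g) :
    2 * (-ν * ‖(p : WithLp 2 (L2per L × L2per L)).snd‖ ^ 2 + β * ‖g‖ ^ 2 + f p)
        - 2 * weakRHS ν β γ f hg.test hg.mean g
      ≤ -(3 * β / 4) * ‖g - hg.test.memLp.toLp φ‖ ^ 2
        + (4 * β * L * (∫ x, g x * δ x ∂(perMeas L)) ^ 2
          + (4 * (β * (∫ x, φ x ^ 2 ∂(perMeas L)) + ν * (∫ x, deriv φ x ^ 2 ∂(perMeas L))
            + γ ^ 2 / ν * ∫ x, iteratedDeriv 2 φ x ^ 2 ∂(perMeas L))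
            + 6 * dualNorm f ^ 2 / ν)) := by
  obtain ⟨hH, H⟩ := p.2
  rw [hpg] at hH H
  set h := (p : WithLp 2 (L2per L × L2per L)).snd with hh
  set N := dualNorm f with hN
  have hN0 : 0 ≤ N := dualNorm_nonneg f
  have hφ1 := hg.test.deriv
  have hφ2 := hg.test.iteratedDeriv 2
  set a := √(∫ x, deriv φ x ^ 2 ∂(perMeas L)) with ha
  set b := √(∫ x, iteratedDeriv 2 φ x ^ 2 ∂(perMeas L)) with hb
  have ha2 : ∫ x, deriv φ x ^ 2 ∂(perMeas L) = a ^ 2 :=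
    (Real.sq_sqrt (integral_nonneg fun x => sq_nonneg _)).symm
  have hb2 : ∫ x, iteratedDeriv 2 φ x ^ 2 ∂(perMeas L) = b ^ 2 :=
    (Real.sq_sqrt (integral_nonneg fun x => sq_nonneg _)).symm
  have ha0 : 0 ≤ a := Real.sqrt_nonneg _
  have hb0 : 0 ≤ b := Real.sqrt_nonneg _
  -- moving derivatives from the test function to the solution
  have e2 : ∫ x, g x * iteratedDeriv 2 φ x ∂(perMeas L) = -∫ x, h x * deriv φ x ∂(perMeas L) := by
    rw [iteratedDeriv_succ, iteratedDeriv_one]; exact H _ hφ1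
  have e3 : ∫ x, g x * iteratedDeriv 3 φ x ∂(perMeas L)
      = -∫ x, h x * iteratedDeriv 2 φ x ∂(perMeas L) := by
    rw [iteratedDeriv_succ]; exact H _ hφ2
  have c2 := (abs_le.1 (abs_integral_mul_le h hφ1.memLp)).2
  have c3 := abs_integral_mul_le h hφ2.memLp
  -- the nonlinear term, which the choice of the slope `4β` makes coercive
  have enl : ∫ x, g x ^ 2 * deriv φ x ∂(perMeas L)
      = 4 * β * (‖g‖ ^ 2 - L * ∫ x, g x ^ 2 * δ x ∂(perMeas L)) := by
    have hδi := integrable_sq_mul g hg.density_test.smooth.continuous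
    rw [norm_sq_L2per, ← integral_const_mul, ← integral_sub (Lp.memLp g).integrable_sq
      (hδi.const_mul L), ← integral_const_mul]
    refine integral_congr_ae (ae_of_all _ fun x => ?_)
    simp only [hg.deriv_eq x]
    ring
  have hconc := H.integral_sq_mul_le hL hg.density_test.smooth.continuous hg.density_nonneg
    hg.density_mass (r := L * σ) (fun x hx y hy hδx hδy => hg.concentrated x y
      (abs_le.2 ⟨by linarith [hx.1, hy.2], by linarith [hx.2, hy.1]⟩) hδx hδy)
  -- the forcing term
  have hf : f p - f (testV φ hg.test hg.mean) ≤ N * (‖h‖ + a) := by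
    rw [← map_sub]
    refine (le_abs_self _).trans ((abs_apply_le_dualNorm hL f _).trans ?_)
    refine mul_le_mul_of_nonneg_left ?_ hN0
    have : ((p - testV φ hg.test hg.mean : VSpace L) : WithLp 2 (L2per L × L2per L)).snd
        = h - hφ1.memLp.toLp (deriv φ) := rfl
    rw [this]
    refine (norm_sub_le _ _).trans (add_le_add_right (le_of_eq ?_) _)
    rw [ha, ← norm_toLp_sq hφ1.memLp, Real.sqrt_sq (norm_nonneg _)]
  rw [norm_sub_toLp_sq, ha2, hb2]
  simp only [weakRHS, e2, e3, enl]
  rw [← ha] at c2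
  rw [← hb] at c3
  set X := ‖h‖
  set m := ∫ x, g x * δ x ∂(perMeas L)
  set D := ∫ x, g x ^ 2 * δ x ∂(perMeas L)
  set G := ‖g‖ ^ 2
  set Φ := ∫ x, φ x ^ 2 ∂(perMeas L)
  set s := ∫ x, g x * φ x ∂(perMeas L)
  set I2 := ∫ x, h x * deriv φ x ∂(perMeas L)
  set I3 := ∫ x, h x * iteratedDeriv 2 φ x ∂(perMeas L)
  have y1 : ν * I2 ≤ ν / 4 * X ^ 2 + ν * a ^ 2 := by
    have := mul_le_mul_of_nonneg_left c2 hν.le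
    nlinarith [mul_nonneg hν.le (sq_nonneg (X / 2 - a))]
  have y2 : γ * I3 ≤ ν / 8 * X ^ 2 + 2 * (γ ^ 2 / ν * b ^ 2) := by
    have h1 : γ * I3 ≤ |γ| * (X * b) := by
      refine (le_abs_self _).trans ?_
      rw [abs_mul]
      exact mul_le_mul_of_nonneg_left c3 (abs_nonneg _)
    have h2 : 0 ≤ (ν * X - 4 * (|γ| * b)) ^ 2 / (8 * ν) := by positivity
    have h3 : (ν * X - 4 * (|γ| * b)) ^ 2 / (8 * ν)
        = ν / 8 * X ^ 2 - |γ| * (X * b) + 2 * (|γ| ^ 2 / ν * b ^ 2) := by field_simp; ring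
    rw [sq_abs] at h3
    linarith
  have y3 : N * X ≤ ν / 8 * X ^ 2 + 2 * (N ^ 2 / ν) := by
    have h2 : 0 ≤ (ν * X - 4 * N) ^ 2 / (8 * ν) := by positivity
    have h3 : (ν * X - 4 * N) ^ 2 / (8 * ν)
        = ν / 8 * X ^ 2 - N * X + 2 * (N ^ 2 / ν) := by field_simp; ring
    linarith
  have y4 : N * a ≤ N ^ 2 / ν + ν * a ^ 2 / 4 := by
    have h2 : 0 ≤ (N - ν * a / 2) ^ 2 / ν := by positivity
    have h3 : (N - ν * a / 2) ^ 2 / ν = N ^ 2 / ν - N * a + ν * a ^ 2 / 4 := by field_simp; ring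
    linarith
  have y5 : 2 * β * L * D ≤ 2 * β * L * m ^ 2 + ν / 4 * X ^ 2 := by
    have h1 := mul_le_mul_of_nonneg_left hconc (by positivity : 0 ≤ 2 * β * L)
    have h2 : 2 * β * L * (m ^ 2 + L * σ * X ^ 2)
        = 2 * β * L * m ^ 2 + (8 * β * L ^ 2 * σ) / 4 * X ^ 2 := by ring
    rw [h2, hσ] at h1
    exact h1
  -- Young's inequality for the cross term with `φ`
  have hs : 7 * |s| ≤ 5 / 2 * G + 13 / 2 * Φ := by
    have h2 : |s| ≤ ‖g‖ * √Φ := abs_integral_mul_le g hg.test.memLp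
    have h3 : √Φ ^ 2 = Φ := Real.sq_sqrt (integral_nonneg fun x => sq_nonneg _)
    nlinarith [sq_nonneg (5 * ‖g‖ - 7 * √Φ), sq_nonneg (√Φ)]
  have y6 := mul_le_mul_of_nonneg_left (neg_abs_le s) hβ.le
  have y7 := mul_le_mul_of_nonneg_left hs hβ.le
  have z1 : 0 ≤ ν * X ^ 2 := by positivity
  have z2 : 0 ≤ ν * a ^ 2 := by positivity
  have e6 : 6 * N ^ 2 / ν = 6 * (N ^ 2 / ν) := by ring
  have z3 : 0 ≤ β * Φ := mul_nonneg hβ.le (integral_nonneg fun x => sq_nonneg _)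
  have z4 : 0 ≤ β * G := by positivity
  rw [e6]
  linarith

/-! ### The distance to the translates of a gauge function -/

theorem hasDerivAt_integral_mul_translate {L : ℝ} (hL : L ≠ 0) (g : L2per L) {φ : ℝ → ℝ}
    (hφ : IsTest L φ) (b : ℝ) :
    HasDerivAt (fun b => ∫ x, g x * φ (x + b) ∂(perMeas L))
      (∫ x, g x * deriv φ (x + b) ∂(perMeas L)) b := by
  obtain ⟨C, hC⟩ := (hφ.deriv.periodic.compact_of_continuous hL
    hφ.deriv.smooth.continuous).isBounded.exists_norm_le
  refine (hasDerivAt_integral_of_dominated_loc_of_deriv_le (s := univ)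
    (bound := fun x => |g x| * C) univ_mem (Eventually.of_forall fun b' => ?_)
    (g.integrable_mul (hφ.translate b)) (F' := fun b x => g x * deriv φ (x + b)) ?_
    (ae_of_all _ fun x b' _ => ?_) (g.integrable.abs.mul_const C)
    (ae_of_all _ fun x b' _ => ?_)).2
  · exact (g.integrable_mul (hφ.translate b')).aestronglyMeasurable
  · exact (g.integrable_mul (hφ.deriv.translate b)).aestronglyMeasurable
  · rw [norm_mul, Real.norm_eq_abs]
    exact mul_le_mul_of_nonneg_left (hC _ (mem_range_self _)) (abs_nonneg _)
  · have h1 := (hφ.smooth.differentiable (by simp) (x + b')).hasDerivAt.comp_const_add x b'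
    exact h1.const_mul (g x)

/-- There is a translate of `φ` closest to `g`, and `g` is orthogonal to its derivative. -/
theorem exists_best_translate {L : ℝ} (hL : 0 < L) (g : L2per L) {φ : ℝ → ℝ} (hφ : IsTest L φ) :
    ∃ b : ℝ, (∀ b', ∫ x, g x * φ (x + b') ∂(perMeas L) ≤ ∫ x, g x * φ (x + b) ∂(perMeas L)) ∧
      ∫ x, g x * deriv φ (x + b) ∂(perMeas L) = 0 := by
  set J : ℝ → ℝ := fun b => ∫ x, g x * φ (x + b) ∂(perMeas L) with hJ
  have hd := hasDerivAt_integral_mul_translate hL.ne' g hφ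
  have hJc : Continuous J := continuous_iff_continuousAt.2 fun b => (hd b).continuousAt
  have hJp : Function.Periodic J L := fun b => by
    simp only [hJ, ← add_assoc, hφ.periodic _]
  obtain ⟨_, ⟨⟨b, rfl⟩, hb⟩⟩ := (hJp.compact_of_continuous hL.ne' hJc).exists_isGreatest
    (range_nonempty J)
  have hmax : ∀ b', J b' ≤ J b := fun b' => hb (mem_range_self b')
  refine ⟨b, hmax, ?_⟩
  exact IsLocalMax.hasDerivAt_eq_zero (Eventually.of_forall hmax) (hd b)

/-- The set of all translates of a test function, as a subset of `L²_per(𝕋)`. -/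
def translates {L : ℝ} {φ : ℝ → ℝ} (hφ : IsTest L φ) : Set (L2per L) :=
  range fun b => (hφ.translate b).memLp.toLp fun x => φ (x + b)

theorem norm_sub_translate_sq {L : ℝ} (hL : 0 < L) (g : L2per L) {φ : ℝ → ℝ} (hφ : IsTest L φ)
    (b : ℝ) : ‖g - (hφ.translate b).memLp.toLp (fun x => φ (x + b))‖ ^ 2
      = ‖g‖ ^ 2 - 2 * (∫ x, g x * φ (x + b) ∂(perMeas L)) + ∫ x, φ x ^ 2 ∂(perMeas L) := by
  rw [norm_sub_toLp_sq, integral_perMeas_comp_add hL (periodic_sq hφ.periodic) b]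

theorem infDist_translates_sq_le {L : ℝ} (g : L2per L) {φ : ℝ → ℝ} (hφ : IsTest L φ) (b : ℝ) :
    Metric.infDist g (translates hφ) ^ 2
      ≤ ‖g - (hφ.translate b).memLp.toLp (fun x => φ (x + b))‖ ^ 2 := by
  rw [← dist_eq_norm]
  exact pow_le_pow_left₀ Metric.infDist_nonneg
    (Metric.infDist_le_dist_of_mem (mem_range_self b)) 2

/-- The distance to the translates of `φ` is attained, at a translate whose derivative is
orthogonal to `g`. -/
theorem exists_infDist_translates_eq {L : ℝ} (hL : 0 < L) (g : L2per L) {φ : ℝ → ℝ}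
    (hφ : IsTest L φ) : ∃ b : ℝ,
      Metric.infDist g (translates hφ)
        = ‖g - (hφ.translate b).memLp.toLp (fun x => φ (x + b))‖ ∧
      ∫ x, g x * deriv φ (x + b) ∂(perMeas L) = 0 := by
  obtain ⟨b, hb, hb0⟩ := exists_best_translate hL g hφ
  refine ⟨b, le_antisymm ?_ ?_, hb0⟩
  · rw [← dist_eq_norm]
    exact Metric.infDist_le_dist_of_mem (mem_range_self b)
  · have hne : (translates hφ).Nonempty := range_nonempty _
    rw [Metric.le_infDist hne]
    rintro _ ⟨b', rfl⟩
    rw [dist_eq_norm]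
    refine le_of_sq_le_sq ?_ (norm_nonneg _)
    rw [norm_sub_translate_sq hL _ hφ, norm_sub_translate_sq hL _ hφ]
    linarith [hb b']

/-- Bounds on the solution in terms of the distance to the translates of the gauge function, which
decays exponentially. -/
theorem IsGauge.decay {L ν β γ σ K : ℝ} (hL : 0 < L) (hν : 0 < ν) (hβ : 0 < β)
    (hσ : 8 * β * L ^ 2 * σ = ν) (f : VDual L) {φ δ : ℝ → ℝ} (hg : IsGauge L β σ K φ δ)
    {u₀ : HSpace L} {u : ℝ → HSpace L} (hu : IsSolution ν β γ f u₀ u) {P : ℝ}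
    (hP : 4 * (β * (∫ x, φ x ^ 2 ∂(perMeas L)) + ν * (∫ x, deriv φ x ^ 2 ∂(perMeas L))
            + γ ^ 2 / ν * ∫ x, iteratedDeriv 2 φ x ^ 2 ∂(perMeas L)) + 6 * dualNorm f ^ 2 / ν ≤ P)
    {t : ℝ} (ht : 0 ≤ t) :
    ‖(u t : L2per L)‖ ^ 2 ≤ Real.exp (-(3 * β / 4) * t)
        * (4 * (‖(u₀ : L2per L)‖ ^ 2 + ∫ x, φ x ^ 2 ∂(perMeas L)))
      + (2 * (P / (3 * β / 4)) + 2 * ∫ x, φ x ^ 2 ∂(perMeas L)) := by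
  obtain ⟨v, hv, hvm⟩ := hu.memL2V
  set Φ := ∫ x, φ x ^ 2 ∂(perMeas L) with hΦ
  have hnorm : ∀ b, ‖(hg.test.translate b).memLp.toLp (fun x => φ (x + b))‖ ^ 2 = Φ := fun b => by
    rw [norm_toLp_sq, integral_perMeas_comp_add hL (periodic_sq hg.test.periodic) b]
  have hP0 : 0 ≤ P := by
    refine le_trans ?_ hP
    have i : ∀ F : ℝ → ℝ, 0 ≤ ∫ x, F x ^ 2 ∂(perMeas L) :=
      fun F => integral_nonneg fun x => sq_nonneg _
    have i1 := i φ
    have i2 := i (deriv φ)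
    have i3 := i (iteratedDeriv 2 φ)
    positivity
  set y : ℝ → ℝ := fun τ => Metric.infDist (u τ : L2per L) (translates hg.test) ^ 2 with hy
  have hyc : ContinuousOn y (Ici 0) :=
    ((Metric.continuous_infDist_pt _).comp_continuousOn hu.continuousOn_coe).pow 2
  have key := le_of_integral_ineq (y := y) (μ := 3 * β / 4) (by positivity) hP0 hyc
    (fun x hx => ?_) ht
  · -- back from the distance to the norm
    obtain ⟨b, hb, -⟩ := exists_infDist_translates_eq hL (u t : L2per L) hg.test
    have h1 : ‖(u t : L2per L)‖ ^ 2 ≤ 2 * y t + 2 * Φ := by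
      have h2 := norm_add_le ((u t : L2per L) - (hg.test.translate b).memLp.toLp
        (fun x => φ (x + b))) ((hg.test.translate b).memLp.toLp (fun x => φ (x + b)))
      rw [sub_add_cancel, ← hb] at h2
      rw [← hnorm b]
      have h3 := pow_le_pow_left₀ (norm_nonneg _) h2 2
      refine h3.trans ?_
      simp only [hy]
      linarith [add_sq_le (a := Metric.infDist (u t : L2per L) (translates hg.test))
        (b := ‖(hg.test.translate b).memLp.toLp (fun x => φ (x + b))‖)]
    have h0 : y 0 ≤ 2 * (‖(u₀ : L2per L)‖ ^ 2 + Φ) := by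
      refine (infDist_translates_sq_le _ hg.test 0).trans ?_
      rw [← hnorm 0, hu.init]
      exact (pow_le_pow_left₀ (norm_nonneg _) (norm_sub_le _ _) 2).trans add_sq_le
    have := mul_le_mul_of_nonneg_left h0 (Real.exp_pos (-(3 * β / 4) * t)).le
    linarith
  · obtain ⟨b, hb, hb0⟩ := exists_infDist_translates_eq hL (u x : L2per L) hg.test
    have hgb := hg.translate hL b
    set w := (hg.test.translate b).memLp.toLp (fun x => φ (x + b)) with hw
    set F : ℝ → ℝ := fun τ => -(3 * β / 4) * ‖(u τ : L2per L) - w‖ ^ 2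
        + (4 * β * L * (∫ x, (u τ : L2per L) x * δ (x + b) ∂(perMeas L)) ^ 2 + P) with hF
    have hFc : ContinuousOn F (Ici 0) := by
      have h1 := (continuous_integral_mul hgb.density_test.memLp).comp_continuousOn
        hu.continuousOn_coe
      have h2 := hu.continuousOn_coe
      have h3 : ContinuousOn (fun τ => ∫ x, (u τ : L2per L) x * δ (x + b) ∂(perMeas L)) (Ici 0) :=
        h1
      simp only [hF]
      fun_prop
    have hδ0 : ∫ y, (u x : L2per L) y * δ (y + b) ∂(perMeas L) = 0 := by
      have e : ∫ y, (u x : L2per L) y * deriv φ (y + b) ∂(perMeas L)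
          = 4 * β * (-(L * ∫ y, (u x : L2per L) y * δ (y + b) ∂(perMeas L))) := by
        have i1 := (u x : L2per L).integrable_mul hgb.density_test
        have m0 : ∫ y, (u x : L2per L) y ∂(perMeas L) = 0 := (u x).2
        rw [← integral_const_mul, ← zero_sub, ← m0, ← integral_sub (u x : L2per L).integrable
          (i1.const_mul L), ← integral_const_mul]
        refine integral_congr_ae (ae_of_all _ fun y => ?_)
        simp only [hg.deriv_eq]
        ring
      rw [hb0] at e
      have h4 : 4 * β ≠ 0 := by positivity
      have h5 := (mul_eq_zero.1 e.symm).resolve_left h4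
      exact (mul_eq_zero.1 (neg_eq_zero.1 h5)).resolve_left hL.ne'
    refine ⟨F, hFc, ?_, fun z hz => ?_⟩
    · simp only [hF, hδ0, hy, hb]
      linarith
    · have h1 := infDist_translates_sq_le (u z : L2per L) hg.test b
      have h2 := hu.energy hL hν.le hv hvm hx hz
      have h3 := hu.pairing_sub hgb.test hgb.mean hx (hx.trans hz)
      have hc := intervalIntegrable_of_continuousOn_Ici
        (hu.continuousOn_weakRHS hgb.test hgb.mean) hx (hx.trans hz)
      have hi := hu.intervalIntegrable_energy hvm hx hz
      have h4 : y z - y x ≤ ∫ τ in x..z, (2 * (-ν * ‖(v τ : WithLp 2 (L2per L × L2per L)).snd‖ ^ 2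
          + β * ‖(u τ : L2per L)‖ ^ 2 + f (v τ))
          - 2 * weakRHS ν β γ f hgb.test hgb.mean (u τ)) := by
        rw [intervalIntegral.integral_sub hi (hc.const_mul 2), ← h2,
          intervalIntegral.integral_const_mul, ← h3]
        simp only [hy]
        rw [hb]
        rw [norm_sub_translate_sq hL _ hg.test] at h1 ⊢
        linarith
      refine h4.trans (intervalIntegral.integral_mono_ae_restrict hz (hi.sub (hc.const_mul 2))
        (intervalIntegrable_of_continuousOn_Ici hFc hx (hx.trans hz)) ?_)
      filter_upwards [ae_fst_eq hv hx] with τ hτ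
      have hr := hgb.rate_le (γ := γ) hL hν hβ hσ f (v τ) hτ
      refine hr.trans ?_
      have e1 := integral_perMeas_comp_add hL (periodic_sq hg.test.periodic) b
      have e2 := integral_perMeas_comp_add hL (periodic_sq hg.test.deriv.periodic) b
      have e3 := integral_perMeas_comp_add hL
        (periodic_sq (hg.test.iteratedDeriv 2).periodic) b
      simp only [deriv_comp_add_const, iteratedDeriv_comp_add_const]
      rw [e1, e2, e3]
      simp only [hF]
      gcongr

/-- The absorbing ball for `β > 0`. -/
theorem exists_absorbingBall_sharpRadius : ∃ c₀ : ℝ, 0 < c₀ ∧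
    ∀ (L ν β γ : ℝ) (f : VDual L), 0 < L → 0 < ν → 0 < β →
      AbsorbingBall ν β γ f (sharpRadius c₀ L ν β γ (dualNorm f)) := by
  obtain ⟨K, hK, hgauge⟩ := exists_gauge
  refine ⟨6000 * K + 100, by positivity, fun L ν β γ f hL hν hβ => ?_⟩
  set N := dualNorm f with hN
  have q1 : 0 < β ^ 2 * L ^ 3 := by positivity
  have q2 : 0 ≤ N ^ 2 / (ν * β) := by positivity
  have q3 : 0 ≤ ν * β * L := by positivity
  have q4 : 0 ≤ γ ^ 2 / ν ^ 4 * β ^ 4 * L ^ 5 := by positivity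
  have hρ2 : sharpRadius (6000 * K + 100) L ν β γ N ^ 2 = (6000 * K + 100)
      * (β ^ 2 * L ^ 3 + N ^ 2 / (ν * β) + ν * β * L + γ ^ 2 / ν ^ 4 * β ^ 4 * L ^ 5) :=
    Real.sq_sqrt (by positivity)
  have hρ0 : 0 ≤ sharpRadius (6000 * K + 100) L ν β γ N := Real.sqrt_nonneg _
  rcases le_or_gt (8 * β * L ^ 2) ν with hlarge | hsmall
  · -- the linear operator is stable by a margin `β`
    have hμ : β ≤ ν * (2 * Real.pi / L) ^ 2 - 2 * β := by
      have h1 : (2 : ℝ) ≤ 2 * Real.pi := by linarith [Real.two_le_pi]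
      have h2 : (2 : ℝ) ^ 2 ≤ (2 * Real.pi) ^ 2 := pow_le_pow_left₀ (by norm_num) h1 2
      have h3 : 8 * β * L ^ 2 * (2 * Real.pi / L) ^ 2 ≤ ν * (2 * Real.pi / L) ^ 2 := by gcongr
      have h4 : 8 * β * L ^ 2 * (2 * Real.pi / L) ^ 2 = 8 * β * (2 * Real.pi) ^ 2 := by field_simp
      nlinarith
    refine absorbingBall_of_stable hL hν f (hβ.trans_le hμ) hρ0 ?_
    rw [hρ2, ← hN]
    have h5 : N ^ 2 / (ν * (ν * (2 * Real.pi / L) ^ 2 - 2 * β)) ≤ N ^ 2 / (ν * β) := by gcongr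
    nlinarith
  · -- the width of the descent of the gauge is chosen so that dissipation controls it
    set σ := ν / (8 * β * L ^ 2) with hσdef
    have hσ : 8 * β * L ^ 2 * σ = ν := by rw [hσdef]; field_simp
    have hσ0 : 0 < σ := by positivity
    have hσ1 : σ ≤ 1 := (div_le_one (by positivity)).2 hsmall.le
    obtain ⟨φ, δ, hg⟩ := hgauge L β σ hL hβ hσ0 hσ1
    set Φ := ∫ x, φ x ^ 2 ∂(perMeas L) with hΦ
    set P := β * (36 * K * (β ^ 2 * L ^ 3) + 2048 * K * (γ ^ 2 / ν ^ 4 * β ^ 4 * L ^ 5)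
      + 6 * (N ^ 2 / (ν * β))) with hPdef
    have hP : 4 * (β * Φ + ν * (∫ x, deriv φ x ^ 2 ∂(perMeas L))
        + γ ^ 2 / ν * ∫ x, iteratedDeriv 2 φ x ^ 2 ∂(perMeas L)) + 6 * N ^ 2 / ν ≤ P := by
      have b1 : β * Φ ≤ β * (K * (β ^ 2 * L ^ 3)) := by gcongr; exact hg.sq_le
      have b2 : ν * (∫ x, deriv φ x ^ 2 ∂(perMeas L)) ≤ ν * (K * (β ^ 2 * L / σ)) := by
        gcongr; exact hg.deriv_sq_le
      have b3 : γ ^ 2 / ν * (∫ x, iteratedDeriv 2 φ x ^ 2 ∂(perMeas L))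
          ≤ γ ^ 2 / ν * (K * (β ^ 2 / (L * σ ^ 3))) := by
        gcongr; exact hg.deriv_two_sq_le
      have e2 : ν * (K * (β ^ 2 * L / σ)) = β * (8 * K * (β ^ 2 * L ^ 3)) := by
        rw [hσdef]; field_simp
      have e3 : γ ^ 2 / ν * (K * (β ^ 2 / (L * σ ^ 3)))
          = β * (512 * K * (γ ^ 2 / ν ^ 4 * β ^ 4 * L ^ 5)) := by
        rw [hσdef]; field_simp; ring
      have e4 : 6 * N ^ 2 / ν = β * (6 * (N ^ 2 / (ν * β))) := by field_simp
      rw [e2] at b2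
      rw [e3] at b3
      rw [e4, hPdef]
      linarith
    have hlim : 2 * (P / (3 * β / 4)) + 2 * Φ < sharpRadius (6000 * K + 100) L ν β γ N ^ 2 := by
      rw [hρ2]
      have e1 : P / (3 * β / 4) = 4 / 3 * (36 * K * (β ^ 2 * L ^ 3)
          + 2048 * K * (γ ^ 2 / ν ^ 4 * β ^ 4 * L ^ 5) + 6 * (N ^ 2 / (ν * β))) := by
        rw [hPdef]; field_simp
      have hΦ' : Φ ≤ K * (β ^ 2 * L ^ 3) := hg.sq_le
      have k1 := mul_nonneg hK.le q1.le
      have k2 := mul_nonneg hK.le q2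
      have k3 := mul_nonneg hK.le q3
      have k4 := mul_nonneg hK.le q4
      rw [e1]
      linarith
    refine absorbingBall_of_decay hρ0 (μ := 3 * β / 4) (by positivity) hlim fun R =>
      ⟨4 * (R ^ 2 + Φ), fun u₀ u hR hu t ht => ?_⟩
    refine (hg.decay hL hν hβ hσ f hu hP ht).trans ?_
    have : ‖(u₀ : L2per L)‖ ≤ R := hR
    gcongr

/-! ### Order of growth of the radius -/

/-- To find the order of growth of a square root it is enough to bound the radicand above and below
by multiples of a square. -/
theorem isTheta_sqrt {l : Filter ℝ} {F g : ℝ → ℝ} {a b : ℝ} (ha : 0 < a)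
    (h : ∀ᶠ x in l, a * g x ^ 2 ≤ F x ∧ F x ≤ b * g x ^ 2) : (fun x => √(F x)) =Θ[l] g := by
  refine ⟨IsBigO.of_bound (√b) ?_, IsBigO.of_bound (√a)⁻¹ ?_⟩
  · filter_upwards [h] with x hx
    rw [Real.norm_of_nonneg (Real.sqrt_nonneg _), Real.norm_eq_abs, ← Real.sqrt_sq_eq_abs,
      ← Real.sqrt_mul' _ (sq_nonneg _)]
    exact Real.sqrt_le_sqrt hx.2
  · filter_upwards [h] with x hx
    have ha' : 0 < √a := Real.sqrt_pos.2 ha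
    rw [Real.norm_of_nonneg (Real.sqrt_nonneg _), Real.norm_eq_abs, ← Real.sqrt_sq_eq_abs,
      inv_mul_eq_div, le_div_iff₀ ha', mul_comm, ← Real.sqrt_mul' _ (sq_nonneg _)]
    exact Real.sqrt_le_sqrt hx.1

theorem rpow_five_halves_sq {x : ℝ} (hx : 0 ≤ x) : (x ^ (5 / 2 : ℝ)) ^ 2 = x ^ 5 := by
  rw [← Real.rpow_natCast, ← Real.rpow_mul hx, ← Real.rpow_natCast]
  norm_num

theorem radius_isTheta_length {c ν β γ N : ℝ} (hc : 0 < c) (hν : 0 < ν) (hβ : 0 < β) (hγ : γ ≠ 0) :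
    (fun L : ℝ => radius c L ν β γ N) =Θ[atTop] (fun L : ℝ => L ^ (5 / 2 : ℝ)) := by
  refine isTheta_sqrt (a := c * (γ ^ 2 / ν ^ 4 * β ^ 5))
    (b := c * (β ^ 2 + N ^ 2 / (ν * β) + ν * β ^ 2 + β ^ 3 + γ ^ 2 / ν ^ 4 * β ^ 5))
    (by positivity) ?_
  filter_upwards [eventually_ge_atTop 1] with L hL
  have hL0 : 0 ≤ L := zero_le_one.trans hL
  rw [rpow_five_halves_sq hL0]
  constructor
  · rw [mul_assoc]
    gcongr
    have : 0 ≤ β ^ 2 * L ^ 3 + N ^ 2 / (ν * β) + ν * β ^ 2 * L + β ^ 3 * L ^ 3 := by positivity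
    linarith
  · rw [mul_assoc c, add_mul, add_mul, add_mul, add_mul]
    have h3 : L ^ 3 ≤ L ^ 5 := pow_le_pow_right₀ hL (by norm_num)
    have h1 : L ≤ L ^ 5 := le_self_pow₀ hL (by norm_num)
    have h0 : 1 ≤ L ^ 5 := one_le_pow₀ hL
    gcongr
    exact le_mul_of_one_le_right (by positivity) h0

theorem radius_isTheta_viscosity {c L β γ N : ℝ} (hc : 0 < c) (hL : 0 < L) (hβ : 0 < β)
    (hγ : γ ≠ 0) : (fun ν : ℝ => radius c L ν β γ N) =Θ[𝓝[>] 0] (fun ν : ℝ => 1 / ν ^ 2) := by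
  refine isTheta_sqrt (a := c * (γ ^ 2 * β ^ 5 * L ^ 5))
    (b := c * (β ^ 2 * L ^ 3 + N ^ 2 / β + β ^ 2 * L + β ^ 3 * L ^ 3 + γ ^ 2 * β ^ 5 * L ^ 5))
    (by positivity) ?_
  filter_upwards [Ioc_mem_nhdsGT (zero_lt_one' ℝ)] with ν hν
  obtain ⟨hν0, hν1⟩ := hν
  have h4 : (1 / ν ^ 2) ^ 2 = 1 / ν ^ 4 := by field_simp
  rw [h4]
  constructor
  · rw [mul_assoc]
    gcongr
    have : 0 ≤ β ^ 2 * L ^ 3 + N ^ 2 / (ν * β) + ν * β ^ 2 * L + β ^ 3 * L ^ 3 := by positivity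
    have e : γ ^ 2 * β ^ 5 * L ^ 5 * (1 / ν ^ 4) = γ ^ 2 / ν ^ 4 * β ^ 5 * L ^ 5 := by ring
    linarith
  · have h0 : 1 ≤ 1 / ν ^ 4 := by
      rw [one_le_div (by positivity)]
      exact pow_le_one₀ hν0.le hν1
    have h1 : 1 / ν ≤ 1 / ν ^ 4 := by
      gcongr
      exact pow_le_of_le_one hν0.le hν1 (by norm_num)
    have h2 : ν ≤ 1 / ν ^ 4 := hν1.trans h0
    rw [mul_assoc c, add_mul, add_mul, add_mul, add_mul]
    have e1 : N ^ 2 / (ν * β) = N ^ 2 / β * (1 / ν) := by field_simp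
    have e2 : ν * β ^ 2 * L = β ^ 2 * L * ν := by ring
    have e3 : γ ^ 2 / ν ^ 4 * β ^ 5 * L ^ 5 = γ ^ 2 * β ^ 5 * L ^ 5 * (1 / ν ^ 4) := by ring
    rw [e1, e2, e3]
    refine mul_le_mul_of_nonneg_left (add_le_add (add_le_add (add_le_add (add_le_add ?_ ?_) ?_) ?_)
      le_rfl) hc.le
    · exact le_mul_of_one_le_right (by positivity) h0
    · gcongr
    · gcongr
    · exact le_mul_of_one_le_right (by positivity) h0

theorem radius_isTheta_growth {c L ν γ N : ℝ} (hc : 0 < c) (hL : 0 < L) (hν : 0 < ν) (hγ : γ ≠ 0) :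
    (fun β : ℝ => radius c L ν β γ N) =Θ[atTop] (fun β : ℝ => β ^ (5 / 2 : ℝ)) := by
  refine isTheta_sqrt (a := c * (γ ^ 2 / ν ^ 4 * L ^ 5))
    (b := c * (L ^ 3 + N ^ 2 / ν + ν * L + L ^ 3 + γ ^ 2 / ν ^ 4 * L ^ 5))
    (by positivity) ?_
  filter_upwards [eventually_ge_atTop 1] with β hβ
  have hβ0 : 0 < β := zero_lt_one.trans_le hβ
  rw [rpow_five_halves_sq hβ0.le]
  constructor
  · rw [mul_assoc]
    gcongr
    have : 0 ≤ β ^ 2 * L ^ 3 + N ^ 2 / (ν * β) + ν * β ^ 2 * L + β ^ 3 * L ^ 3 := by positivity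
    linarith
  · have h3 : β ^ 3 ≤ β ^ 5 := pow_le_pow_right₀ hβ (by norm_num)
    have h2 : β ^ 2 ≤ β ^ 5 := pow_le_pow_right₀ hβ (by norm_num)
    have h0 : 1 / β ≤ β ^ 5 := ((div_le_one hβ0).2 hβ).trans (one_le_pow₀ hβ)
    rw [mul_assoc c, add_mul, add_mul, add_mul, add_mul]
    have e : β ^ 2 * L ^ 3 + N ^ 2 / (ν * β) + ν * β ^ 2 * L + β ^ 3 * L ^ 3
        + γ ^ 2 / ν ^ 4 * β ^ 5 * L ^ 5
        = L ^ 3 * β ^ 2 + N ^ 2 / ν * (1 / β) + ν * L * β ^ 2 + L ^ 3 * β ^ 3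
        + γ ^ 2 / ν ^ 4 * L ^ 5 * β ^ 5 := by field_simp
    rw [e]
    gcongr

theorem radius_isTheta_dispersion {c L ν β N : ℝ} (hc : 0 < c) (hL : 0 < L) (hν : 0 < ν)
    (hβ : 0 < β) : (fun γ : ℝ => radius c L ν β γ N) =Θ[cocompact ℝ] (fun γ : ℝ => γ) := by
  refine isTheta_sqrt (a := c * (β ^ 5 * L ^ 5 / ν ^ 4))
    (b := c * (β ^ 2 * L ^ 3 + N ^ 2 / (ν * β) + ν * β ^ 2 * L + β ^ 3 * L ^ 3
      + β ^ 5 * L ^ 5 / ν ^ 4)) (by positivity) ?_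
  filter_upwards [(tendsto_norm_cocompact_atTop (E := ℝ)).eventually_ge_atTop 1] with γ hγ
  have h1 : 1 ≤ γ ^ 2 := by
    rw [← sq_abs]
    exact one_le_pow₀ hγ
  have h0 : 0 ≤ β ^ 2 * L ^ 3 + N ^ 2 / (ν * β) + ν * β ^ 2 * L + β ^ 3 * L ^ 3 := by positivity
  have e : γ ^ 2 / ν ^ 4 * β ^ 5 * L ^ 5 = β ^ 5 * L ^ 5 / ν ^ 4 * γ ^ 2 := by ring
  rw [e]
  constructor
  · rw [mul_assoc]
    gcongr
    linarith
  · rw [mul_assoc c, add_mul _ (β ^ 5 * L ^ 5 / ν ^ 4)]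
    gcongr
    exact le_mul_of_one_le_right h0 h1

theorem sharpRadius_le_radius {c c' L ν β γ N : ℝ} (hc : 0 < c) (hcc : c ≤ c') (hL : 0 < L)
    (hν : 0 < ν) (hβ : 1 ≤ β) : sharpRadius c L ν β γ N ≤ radius c' L ν β γ N := by
  have hβ0 : 0 < β := zero_lt_one.trans_le hβ
  refine Real.sqrt_le_sqrt (mul_le_mul hcc ?_ (by positivity) (by linarith))
  have h1 : ν * β * L ≤ ν * β ^ 2 * L := by gcongr; exact le_self_pow₀ hβ (by norm_num)
  have h2 : γ ^ 2 / ν ^ 4 * β ^ 4 * L ^ 5 ≤ γ ^ 2 / ν ^ 4 * β ^ 5 * L ^ 5 := by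
    gcongr
    norm_num
  have h3 : 0 ≤ β ^ 3 * L ^ 3 := by positivity
  linarith

theorem sharpRadius_le_of_one_le {c L ν β γ N : ℝ} (hc : 0 < c) (hν : 0 < ν) (hν1 : ν ≤ 1)
    (hL : 1 ≤ L) (hβ : 1 ≤ β) (hγ : 1 ≤ |γ|) :
    sharpRadius c L ν β γ N
      ≤ √(3 * c * (N ^ 2 / (ν * β) + γ ^ 2 / ν ^ 4 * β ^ 5 * L ^ 5)) := by
  have hβ0 : 0 < β := zero_lt_one.trans_le hβ
  have hL0 : 0 < L := zero_lt_one.trans_le hL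
  have hγ2 : 1 ≤ γ ^ 2 / ν ^ 4 := by
    rw [one_le_div (by positivity), ← sq_abs]
    exact (pow_le_one₀ hν.le hν1).trans (one_le_pow₀ hγ)
  have key : β ^ 5 * L ^ 5 ≤ γ ^ 2 / ν ^ 4 * β ^ 5 * L ^ 5 := by
    rw [mul_assoc]
    exact le_mul_of_one_le_left (by positivity) hγ2
  have h1 : β ^ 2 * L ^ 3 ≤ β ^ 5 * L ^ 5 := by gcongr <;> first | assumption | norm_num
  have h2 : ν * β * L ≤ β ^ 5 * L ^ 5 := by
    have a1 : β ≤ β ^ 5 := le_self_pow₀ hβ (by norm_num)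
    have a2 : L ≤ L ^ 5 := le_self_pow₀ hL (by norm_num)
    have a3 : ν * β ≤ β := mul_le_of_le_one_left hβ0.le hν1
    exact mul_le_mul (a3.trans a1) a2 hL0.le (by positivity)
  have h3 : γ ^ 2 / ν ^ 4 * β ^ 4 * L ^ 5 ≤ γ ^ 2 / ν ^ 4 * β ^ 5 * L ^ 5 := by
    gcongr
    norm_num
  have h4 : 0 ≤ N ^ 2 / (ν * β) := by positivity
  refine Real.sqrt_le_sqrt ?_
  rw [mul_comm 3 c, mul_assoc c]
  gcongr
  linarith

end KBS

theorem theorem2 :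
    ∃ c : ℝ, 0 < c ∧
      -- absorbing balls, with one dimensionless constant `c` for all values of the parameters
      (∀ (L ν β γ : ℝ) (f : KBS.VDual L), 0 < L → 0 < ν → γ ≠ 0 →
        (0 < β →
          KBS.AbsorbingBall ν β γ f (KBS.sharpRadius c L ν β γ (KBS.dualNorm f))) ∧
        (1 ≤ β →
          KBS.AbsorbingBall ν β γ f (KBS.radius c L ν β γ (KBS.dualNorm f))) ∧
        (ν ≤ 1 → 1 ≤ L → 1 ≤ β → 1 ≤ |γ| →
          KBS.AbsorbingBall ν β γ f
            (√(c * (KBS.dualNorm f ^ 2 / (ν * β) + γ ^ 2 / ν ^ 4 * β ^ 5 * L ^ 5)))) ∧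
        (β ≤ 0 → ∀ ρ : ℝ, 0 < ρ →
          KBS.dualNorm f ^ 2 / (ν * (ν * (2 * Real.pi / L) ^ 2 - 2 * β)) < ρ ^ 2 →
          KBS.AbsorbingBall ν β γ f ρ)) ∧
      -- behaviour of the radius in each parameter, the others (and `|A^(-1/2) f| = N`) being fixed
      (∀ ν β γ N : ℝ, 0 < ν → 0 < β → γ ≠ 0 → 0 ≤ N →
        (fun L : ℝ => KBS.radius c L ν β γ N) =Θ[atTop] (fun L : ℝ => L ^ (5 / 2 : ℝ))) ∧
      (∀ L β γ N : ℝ, 0 < L → 0 < β → γ ≠ 0 → 0 ≤ N →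
        (fun ν : ℝ => KBS.radius c L ν β γ N) =Θ[𝓝[>] 0] (fun ν : ℝ => 1 / ν ^ 2)) ∧
      (∀ L ν γ N : ℝ, 0 < L → 0 < ν → γ ≠ 0 → 0 ≤ N →
        (fun β : ℝ => KBS.radius c L ν β γ N) =Θ[atTop] (fun β : ℝ => β ^ (5 / 2 : ℝ))) ∧
      (∀ L ν β N : ℝ, 0 < L → 0 < ν → 0 < β → 0 ≤ N →
        (fun γ : ℝ => KBS.radius c L ν β γ N) =Θ[cocompact ℝ] (fun γ : ℝ => γ)) := by
  obtain ⟨c₀, hc₀, hsharp⟩ := KBS.exists_absorbingBall_sharpRadius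
  have hc : 0 < 3 * c₀ := by positivity
  refine ⟨3 * c₀, hc,
    fun L ν β γ f hL hν _ => ⟨fun hβ => ?_, fun hβ => ?_, fun hν1 hL1 hβ1 hγ1 => ?_,
    fun hβ ρ hρ hlt => ?_⟩, fun ν β γ N hν hβ hγ _ => KBS.radius_isTheta_length hc hν hβ hγ,
    fun L β γ N hL hβ hγ _ => KBS.radius_isTheta_viscosity hc hL hβ hγ,
    fun L ν γ N hL hν hγ _ => KBS.radius_isTheta_growth hc hL hν hγ,
    fun L ν β N hL hν hβ _ => KBS.radius_isTheta_dispersion hc hL hν hβ⟩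
  · refine (hsharp L ν β γ f hL hν hβ).mono (Real.sqrt_le_sqrt ?_)
    gcongr
    linarith
  · exact (hsharp L ν β γ f hL hν (by linarith)).mono
      (KBS.sharpRadius_le_radius hc₀ (by linarith) hL hν hβ)
  · exact (hsharp L ν β γ f hL hν (by linarith)).mono
      (KBS.sharpRadius_le_of_one_le hc₀ hν hν1 hL1 hβ1 hγ1)
  · have hμ : 0 < ν * (2 * Real.pi / L) ^ 2 - 2 * β := by
      have h1 : 0 < ν * (2 * Real.pi / L) ^ 2 := by have := Real.pi_pos; positivity
      linarith
    exact KBS.absorbingBall_of_stable hL hν f hμ hρ.le hlt
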